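/- Let $F$ be a field, let $n\ge 3$ be an integer, and let $H$ be a group. Then the following conditions are equivalent: 1. $H\equiv SL_n(F)$, that is, $H$ and $SL_n(F)$ satisfy the same first-order sentences of the language of groups; 2. $H\cong SL_n(L)$ for some field $L$ with $L\equiv F$, that is, for some field $L$ that satisfies the same first-order sentences of the language of rings as $F$. -/

import Mathlib

universe u v

/-- The function symbols `·`, `⁻¹`, `1` of the first-order language of groups. -/
inductive GroupFunc : ℕ → Type
  | mul : GroupFunc 2
  | inv : GroupFunc 1
  | one : GroupFunc 0

/-- The first-order language of groups, with signature `(·, ⁻¹, 1)` and no relation symbols. -/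
def groupLanguage : FirstOrder.Language where
  Functions := GroupFunc
  Relations := fun _ => Empty

/-- The interpretation of the language of groups in a group. -/
instance groupStructure (G : Type*) [Group G] : groupLanguage.Structure G where
  funMap := fun {n} f =>
    match n, f with
    | _, .mul => fun x => x 0 * x 1
    | _, .inv => fun x => (x 0)⁻¹
    | _, .one => fun _ => 1
  RelMap := fun r => nomatch r

/-- Elementary equivalence of groups `G ≡ H`: the same sentences of the language of groups hold
in `G` and in `H`. -/
def GroupElemEquiv (G H : Type*) [Group G] [Group H] : Prop :=
  groupLanguage.ElementarilyEquivalent G H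

/-- Elementary equivalence of fields `F ≡ L`: the same sentences of the language of rings
`(+, ·, -, 0, 1)`, with its usual interpretation, hold in `F` and in `L`. -/
def FieldElemEquiv (F L : Type*) [Field F] [Field L] : Prop :=
  letI := FirstOrder.Ring.compatibleRingOfRing F
  letI := FirstOrder.Ring.compatibleRingOfRing L
  FirstOrder.Language.ring.ElementarilyEquivalent F L

/-!
The implication from fields to groups is an interpretation. A matrix of determinant one is a tuple
of elements of the field, and multiplication of matrices and the condition on the determinant are
given by polynomials with integer coefficients, so each sentence about `SL_n(K)` is equivalent to a
sentence about `K` that does not depend on the field `K` (`BoundedFormula.exists_translation`,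
`FieldElemEquiv.specialLinearGroup`).

For the converse, the field is recovered inside the group. Write `x_{ij}(t)` for the elementary
matrix `1 + t E_{ij}`. The double centralizer of `x_{01}(1)` in `SL_n(K)` consists of the products
of a central element and some `x_{01}(t)` (`exists_eq_center_mul_transvection`), so the commutators
of its elements with `x_{12}(1)` form exactly the group of all `x_{02}(t)`. This is a definable copy
of the additive group of `K`; its multiplication comes from `[x_{01}(s), x_{12}(t)] = x_{02}(s t)`,
where the other root groups are obtained from this one by conjugation with finitely many
parameters. Every element of `SL_n(K)` is a product of elementary matrices whose number is bounded
in terms of `n` (`exists_eq_prod_transvection`), and whether the product of two such words is a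
third one is a first-order condition on the entries. Hence there is a formula in the language of
groups, about a tuple `p` of parameters, saying that the coordinates defined by `p` form a field
and that multiplication of words of bounded length is the one of `SL_n` over this field
(`CoordSystem.IsCoordinatized`, `uniformlyDefinable_isCoordinatized`). In any group in which some
tuple satisfies the formula, comparing words gives an isomorphism with `SL_n` over the field of
coordinates (`CoordSystem.IsCoordinatized.nonempty_mulEquiv`). Such a tuple exists in `SL_n(F)`
(`exists_isCoordinatized`), hence in each group `H` elementarily equivalent to it, so that
`H ≅ SL_n(L)` for a field `L`.

It remains to compare the theories of `L` and `F`. For a sentence `σ` true in `F`, the group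
`SL_n(F)` satisfies "each tuple of parameters as above has a field of coordinates satisfying `σ`":
for each such tuple the field of coordinates `K` has `SL_n(K) ≅ SL_n(F)`, and this implies
`K ≅ F` (`nonempty_ringEquiv_of_mulEquiv_specialLinearGroup`). So `H` satisfies it as well, and
`σ` holds in `L`. The formula on the parameters may in addition fix the characteristic as far as
needed: with `p = char F`, the image of `p` in `K` is zero and, if `p = 0`, the image of `n!` is
not. Under this assumption an isomorphism maps elementary matrices to
unipotent ones (`isNilpotent_map_transvection_sub_one`). An argument as in Kolchin's theorem then
gives a flag of length `n` of `F^n` whose terms are lowered by the image of the unitriangular group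
(`exists_notMem_fixed_unitriangular`). The corner matrix `x_{0,n-1}(1)` is an `(n-1)`-fold
commutator of unitriangular elementary matrices, so its image lowers the flag by `n - 1` steps and
is a transvection `1 + N` (`exists_eq_one_add_vecMulVec`). By the description of double
centralizers, `x_{0,n-1}(t)` is mapped to `1 + f(t) N` with a bijection `f` of the fields. It is
additive, and conjugation with diagonal matrices shows that it is multiplicative.
-/

/-! ### Uniform definability and interpretations -/

namespace FirstOrder.Language

theorem Sentence.realize_iff_boundedFormula {L : Language} {M : Type*} [L.Structure M]
    (φ : L.Sentence) (v : Empty → M) (xs : Fin 0 → M) :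
    M ⊨ φ ↔ BoundedFormula.Realize φ v xs := by
  rw [Sentence.Realize, Formula.Realize, Subsingleton.elim v default,
    Subsingleton.elim xs default]

section Uniform

variable {L : Language.{0, 0}} {ι : Type*} {M : ι → Type*} [∀ i, L.Structure (M i)]
variable {α β : Type*}

variable (L) in
/-- A family of predicates, one on each structure `M i`, is uniformly definable if one and the same
`L`-formula defines all of them. -/
def UniformlyDefinable (P : ∀ i, (α → M i) → Prop) : Prop :=
  ∃ φ : L.Formula α, ∀ i v, φ.Realize v ↔ P i v

variable (L) in
/-- A family of operations, one on each structure `M i`, is a uniform term if one and the same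
`L`-term computes all of them. -/
def UniformTerm (t : ∀ i, (α → M i) → M i) : Prop :=
  ∃ τ : L.Term α, ∀ i v, τ.realize v = t i v

theorem UniformTerm.var (a : α) : UniformTerm L (M := M) fun _ v => v a :=
  ⟨.var a, fun _ _ => rfl⟩

theorem UniformTerm.eq {s t : ∀ i, (α → M i) → M i} (hs : UniformTerm L s)
    (ht : UniformTerm L t) : UniformlyDefinable L fun i v => s i v = t i v := by
  obtain ⟨σ, hσ⟩ := hs
  obtain ⟨τ, hτ⟩ := ht
  exact ⟨σ.equal τ, fun i v => by rw [Formula.realize_equal, hσ, hτ]⟩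

theorem UniformTerm.func {k : ℕ} (f : L.Functions k) {t : Fin k → ∀ i, (α → M i) → M i}
    (ht : ∀ j, UniformTerm L (t j)) :
    UniformTerm L fun i v => Structure.funMap f fun j => t j i v := by
  choose τ hτ using ht
  exact ⟨.func f τ, fun i v => by simp only [Term.realize_func, hτ]⟩

namespace UniformlyDefinable

theorem congr {P Q : ∀ i, (α → M i) → Prop} (hP : UniformlyDefinable L P)
    (h : ∀ i v, P i v ↔ Q i v) : UniformlyDefinable L Q := by
  obtain ⟨φ, hφ⟩ := hP
  exact ⟨φ, fun i v => (hφ i v).trans (h i v)⟩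

theorem of_formula (φ : L.Formula α) :
    UniformlyDefinable L (M := M) fun _ v => φ.Realize v :=
  ⟨φ, fun _ _ => Iff.rfl⟩

theorem const (p : Prop) : UniformlyDefinable L (M := M) (α := α) fun _ _ => p := by
  by_cases hp : p
  · exact ⟨⊤, fun i v => by simp [hp]⟩
  · exact ⟨⊥, fun i v => by simp [hp]⟩

theorem not {P : ∀ i, (α → M i) → Prop} (hP : UniformlyDefinable L P) :
    UniformlyDefinable L fun i v => ¬ P i v := by
  obtain ⟨φ, hφ⟩ := hP
  exact ⟨φ.not, fun i v => by rw [Formula.realize_not, hφ]⟩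

theorem and {P Q : ∀ i, (α → M i) → Prop} (hP : UniformlyDefinable L P)
    (hQ : UniformlyDefinable L Q) : UniformlyDefinable L fun i v => P i v ∧ Q i v := by
  obtain ⟨φ, hφ⟩ := hP
  obtain ⟨ψ, hψ⟩ := hQ
  exact ⟨φ ⊓ ψ, fun i v => by rw [Formula.realize_inf, hφ, hψ]⟩

theorem imp {P Q : ∀ i, (α → M i) → Prop} (hP : UniformlyDefinable L P)
    (hQ : UniformlyDefinable L Q) : UniformlyDefinable L fun i v => P i v → Q i v := by
  obtain ⟨φ, hφ⟩ := hP
  obtain ⟨ψ, hψ⟩ := hQ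
  exact ⟨φ.imp ψ, fun i v => by rw [Formula.realize_imp, hφ, hψ]⟩

theorem iff {P Q : ∀ i, (α → M i) → Prop} (hP : UniformlyDefinable L P)
    (hQ : UniformlyDefinable L Q) : UniformlyDefinable L fun i v => (P i v ↔ Q i v) := by
  obtain ⟨φ, hφ⟩ := hP
  obtain ⟨ψ, hψ⟩ := hQ
  exact ⟨φ.iff ψ, fun i v => by rw [Formula.realize_iff, hφ, hψ]⟩

theorem forall_finite {κ : Type*} [Finite κ] {P : κ → ∀ i, (α → M i) → Prop}
    (hP : ∀ k, UniformlyDefinable L (P k)) : UniformlyDefinable L fun i v => ∀ k, P k i v := by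
  choose φ hφ using hP
  exact ⟨Formula.iInf φ, fun i v => by simp only [Formula.realize_iInf, hφ]⟩

theorem exists_finite {κ : Type*} [Finite κ] {P : κ → ∀ i, (α → M i) → Prop}
    (hP : ∀ k, UniformlyDefinable L (P k)) : UniformlyDefinable L fun i v => ∃ k, P k i v := by
  choose φ hφ using hP
  exact ⟨Formula.iSup φ, fun i v => by simp only [Formula.realize_iSup, hφ]⟩

theorem comp {P : ∀ i, (α → M i) → Prop} (hP : UniformlyDefinable L P) (g : α → β) :
    UniformlyDefinable L fun i v => P i (v ∘ g) := by
  obtain ⟨φ, hφ⟩ := hP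
  exact ⟨φ.relabel g, fun i v => by rw [Formula.realize_relabel, hφ]⟩

theorem subst {P : ∀ i, (α → M i) → Prop} (hP : UniformlyDefinable L P)
    {t : α → ∀ i, (β → M i) → M i} (ht : ∀ a, UniformTerm L (t a)) :
    UniformlyDefinable L fun i v => P i fun a => t a i v := by
  obtain ⟨φ, hφ⟩ := hP
  choose τ hτ using ht
  exact ⟨BoundedFormula.subst φ τ, fun i v => by
    simp only [Formula.Realize, BoundedFormula.realize_subst, hτ]
    exact hφ i _⟩

theorem forall_fun [Finite β] {P : ∀ i, (α → M i) → (β → M i) → Prop}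
    (hP : UniformlyDefinable L fun i (w : α ⊕ β → M i) =>
      P i (fun a => w (.inl a)) (fun b => w (.inr b))) :
    UniformlyDefinable L fun i v => ∀ x, P i v x := by
  obtain ⟨φ, hφ⟩ := hP
  exact ⟨φ.iAlls β, fun i v => by simp only [Formula.realize_iAlls, hφ, Sum.elim_inl, Sum.elim_inr]⟩

theorem exists_fun [Finite β] {P : ∀ i, (α → M i) → (β → M i) → Prop}
    (hP : UniformlyDefinable L fun i (w : α ⊕ β → M i) =>
      P i (fun a => w (.inl a)) (fun b => w (.inr b))) :
    UniformlyDefinable L fun i v => ∃ x, P i v x := by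
  obtain ⟨φ, hφ⟩ := hP
  exact ⟨φ.iExs β, fun i v => by simp only [Formula.realize_iExs, hφ, Sum.elim_inl, Sum.elim_inr]⟩

theorem forall_elem {P : ∀ i, (α → M i) → M i → Prop}
    (hP : UniformlyDefinable L fun i (w : α ⊕ Unit → M i) =>
      P i (fun a => w (.inl a)) (w (.inr ()))) :
    UniformlyDefinable L fun i v => ∀ x, P i v x :=
  (forall_fun (P := fun i v x => P i v (x ())) hP).congr fun _ _ =>
    ⟨fun h x => h fun _ => x, fun h x => h (x ())⟩

theorem exists_elem {P : ∀ i, (α → M i) → M i → Prop}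
    (hP : UniformlyDefinable L fun i (w : α ⊕ Unit → M i) =>
      P i (fun a => w (.inl a)) (w (.inr ()))) :
    UniformlyDefinable L fun i v => ∃ x, P i v x :=
  (exists_fun (P := fun i v x => P i v (x ())) hP).congr fun _ _ =>
    ⟨fun ⟨x, h⟩ => ⟨x (), h⟩, fun ⟨x, h⟩ => ⟨fun _ => x, h⟩⟩

/-- Elementarily equivalent members of a family satisfy the same uniformly definable closed
conditions. -/
theorem iff_of_elementarilyEquivalent {P : ∀ i, (Empty → M i) → Prop}
    (hP : UniformlyDefinable L P) {i j : ι} (h : L.ElementarilyEquivalent (M i) (M j)) :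
    P i Empty.elim ↔ P j Empty.elim := by
  obtain ⟨φ, hφ⟩ := hP
  rw [← hφ, ← hφ]
  have := h.realize_sentence φ
  rwa [Sentence.Realize, Sentence.Realize, Subsingleton.elim (default : Empty → M i) Empty.elim,
    Subsingleton.elim (default : Empty → M j) Empty.elim] at this

end UniformlyDefinable

end Uniform

section Interpretation

variable {L L' : Language.{0, 0}} {ι : Type*} {M N : ι → Type*}
  [∀ i, L.Structure (M i)] [∀ i, L'.Structure (N i)] {α C P : Type*}
  {e : ∀ i, N i → C → M i} {p : ∀ i, P → M i}

theorem Term.exists_translation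
    (hfun : ∀ k (f : L'.Functions k) (c : C), ∃ τ : L.Term ((Fin k × C) ⊕ P),
      ∀ i (x : Fin k → N i), τ.realize (Sum.elim (fun q => e i (x q.1) q.2) (p i)) =
        e i (Structure.funMap f x) c)
    (t : L'.Term α) (c : C) : ∃ τ : L.Term ((α × C) ⊕ P), ∀ i (v : α → N i),
      τ.realize (Sum.elim (fun q => e i (v q.1) q.2) (p i)) = e i (t.realize v) c := by
  induction t generalizing c with
  | var a => exact ⟨.var (.inl (a, c)), fun i v => rfl⟩
  | func f ts ih =>
    choose τ hτ using ih
    obtain ⟨σ, hσ⟩ := hfun _ f c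
    refine ⟨σ.subst (Sum.elim (fun q => τ q.1 q.2) fun x => .var (.inr x)), fun i v => ?_⟩
    rw [Term.realize_subst, Term.realize_func, ← hσ]
    congr 1
    ext q
    rcases q with q | q
    · simp [hτ]
    · rfl

/-- Let the structures `N i` be interpreted in the structures `M i` with parameters `p i`, an
element `x` of `N i` being coded by the tuple `e i x` of elements of `M i`. If the set of codes and
the codes of the values of all function symbols are given uniformly by formulas and terms, then each
formula about the `N i` is uniformly equivalent to a formula about the `M i`. -/
theorem BoundedFormula.exists_translation [L'.IsAlgebraic] [Finite C]
    (he : ∀ i, Function.Injective (e i))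
    (hdom : ∃ δ : L.Formula (C ⊕ P), ∀ i (c : C → M i),
      δ.Realize (Sum.elim c (p i)) ↔ c ∈ Set.range (e i))
    (hfun : ∀ k (f : L'.Functions k) (c : C), ∃ τ : L.Term ((Fin k × C) ⊕ P),
      ∀ i (x : Fin k → N i), τ.realize (Sum.elim (fun q => e i (x q.1) q.2) (p i)) =
        e i (Structure.funMap f x) c)
    {k : ℕ} (φ : L'.BoundedFormula α k) :
    ∃ ψ : L.Formula (((α ⊕ Fin k) × C) ⊕ P), ∀ i (v : α → N i) (xs : Fin k → N i),
      ψ.Realize (Sum.elim (fun q => e i (Sum.elim v xs q.1) q.2) (p i)) ↔ φ.Realize v xs := by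
  induction φ with
  | falsum => exact ⟨⊥, fun i v xs => by simp [BoundedFormula.Realize]⟩
  | equal s t =>
    choose σ hσ using Term.exists_translation hfun s
    choose τ hτ using Term.exists_translation hfun t
    refine ⟨Formula.iInf fun c => (σ c).equal (τ c), fun i v xs => ?_⟩
    simp only [Formula.realize_iInf, Formula.realize_equal, hσ, hτ]
    exact funext_iff.symm.trans (he i).eq_iff
  | rel R => exact isEmptyElim R
  | imp φ₁ φ₂ ih₁ ih₂ =>
    obtain ⟨ψ₁, h₁⟩ := ih₁
    obtain ⟨ψ₂, h₂⟩ := ih₂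
    exact ⟨ψ₁.imp ψ₂, fun i v xs => by
      rw [Formula.realize_imp, h₁, h₂, BoundedFormula.realize_imp]⟩
  | @all k φ ih =>
    obtain ⟨ψ, hψ⟩ := ih
    obtain ⟨δ, hδ⟩ := hdom
    let g : ((α ⊕ Fin (k + 1)) × C) ⊕ P → (((α ⊕ Fin k) × C) ⊕ P) ⊕ C :=
      Sum.elim (fun q => Sum.elim (fun a => .inl (.inl (.inl a, q.2)))
        (fun j => (Fin.snoc (α := fun _ => C → (((α ⊕ Fin k) × C) ⊕ P) ⊕ C)
          (fun j' c => .inl (.inl (.inr j', c))) (fun c => .inr c) j) q.2) q.1)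
        (fun x => .inl (.inr x))
    let g' : C ⊕ P → (((α ⊕ Fin k) × C) ⊕ P) ⊕ C := Sum.elim .inr (fun x => .inl (.inr x))
    refine ⟨((δ.relabel g').imp (ψ.relabel g)).iAlls C, fun i v xs => ?_⟩
    have key : ∀ y : N i, (Sum.elim (Sum.elim (fun q => e i (Sum.elim v xs q.1) q.2) (p i))
        (e i y)) ∘ g =
        Sum.elim (fun q => e i (Sum.elim v (Fin.snoc (α := fun _ => N i) xs y) q.1) q.2)
          (p i) := by
      intro y
      ext q
      rcases q with ⟨a | j, c⟩ | x
      · rfl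
      · refine Fin.lastCases ?_ (fun j => ?_) j <;> simp [g]
      · rfl
    have key' : ∀ c : C → M i, (Sum.elim (Sum.elim (fun q => e i (Sum.elim v xs q.1) q.2) (p i))
        c) ∘ g' = Sum.elim c (p i) := by
      intro c
      ext q
      rcases q with q | q <;> rfl
    have hrw : ∀ c : C → M i, (fun a => Sum.elim (Sum.elim
        (fun q : (α ⊕ Fin k) × C => e i (Sum.elim v xs q.1) q.2) (p i)) c a) =
        Sum.elim (Sum.elim (fun q => e i (Sum.elim v xs q.1) q.2) (p i)) c := fun _ => rfl
    simp only [Formula.realize_iAlls, Formula.realize_imp, Formula.realize_relabel, hrw, key',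
      hδ, BoundedFormula.realize_all]
    constructor
    · intro h y
      rw [← hψ, ← key]
      exact h _ ⟨y, rfl⟩
    · rintro h _ ⟨y, rfl⟩
      rw [key, hψ]
      exact h y

end Interpretation

end FirstOrder.Language

/-! ### Transvections and double centralizers in the special linear group -/

section Transvections

open Matrix Matrix.SpecialLinearGroup
open scoped commutatorElement

variable {ι K : Type*} [Fintype ι] [Field K]

theorem exists_ne_zero_dotProduct_pair_eq_zero (hι : 3 ≤ Fintype.card ι) (v w : ι → K) :
    ∃ ψ : ι → K, ψ ≠ 0 ∧ ψ ⬝ᵥ v = 0 ∧ ψ ⬝ᵥ w = 0 := by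
  let f : (ι → K) →ₗ[K] (Fin 2 → K) := LinearMap.pi ![(dotProductBilin K K).flip v,
    (dotProductBilin K K).flip w]
  have hf : LinearMap.ker f ≠ ⊥ := LinearMap.ker_ne_bot_of_finrank_lt <| by
    simp; omega
  obtain ⟨ψ, hψ, h0⟩ := Submodule.exists_mem_ne_zero_of_ne_bot hf
  refine ⟨ψ, h0, ?_, ?_⟩
  · simpa [f] using congrFun hψ 0
  · simpa [f] using congrFun hψ 1

variable [DecidableEq ι]

theorem transvection_pow {i j : ι} (hij : i ≠ j) (t : K) (m : ℕ) :
    transvection hij t ^ m = transvection hij (m * t) := by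
  induction m with
  | zero => simp
  | succ m ih => rw [pow_succ, ih, ← transvection_add]; push_cast; ring_nf

theorem transvection_injective {i j : ι} (hij : i ≠ j) :
    Function.Injective (transvection (F := K) hij) := by
  intro s t h
  simpa [transvection_coe, hij] using congrArg (fun g => g.1 i j) h

theorem commute_transvection {i j k l : ι} (hij : i ≠ j) (hkl : k ≠ l) (hjk : j ≠ k)
    (hli : l ≠ i) (s t : K) : Commute (transvection hij s) (transvection hkl t) :=
  Subtype.ext <| by
    simp [transvection_coe, mul_add, add_mul, single_mul_single_of_ne _ _ _ _ hjk,
      single_mul_single_of_ne _ _ _ _ hli, add_comm, add_left_comm]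

theorem commutator_transvection {i j k : ι} (hij : i ≠ j) (hjk : j ≠ k) (hik : i ≠ k)
    (s t : K) : ⁅transvection hij s, transvection hjk t⁆ = transvection hik (s * t) := by
  rw [commutatorElement_def, mul_inv_eq_iff_eq_mul, mul_inv_eq_iff_eq_mul]
  refine Subtype.ext ?_
  simp [transvection_coe, mul_add, add_mul, single_mul_single_of_ne _ _ _ _ hik.symm,
    single_mul_single_of_ne _ _ _ _ hjk.symm,
    add_assoc, add_comm, add_left_comm]

/-- A general transvection `1 + a ψ`, where `ψ` is a linear form that vanishes on `a`. -/
def vecTransvection (a ψ : ι → K) (h : ψ ⬝ᵥ a = 0) : SpecialLinearGroup ι K :=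
  ⟨1 + vecMulVec a ψ, by
    rw [vecMulVec_eq Unit, det_one_add_replicateCol_mul_replicateRow, h, add_zero]⟩

theorem coe_vecTransvection (a ψ : ι → K) (h : ψ ⬝ᵥ a = 0) :
    (vecTransvection a ψ h).1 = 1 + vecMulVec a ψ := rfl

/-- The double centralizer of a transvection `1 + v φ` in dimension at least three: a matrix that
commutes with all elements of the special linear group commuting with `v φ` is a linear combination
of `1` and `v φ`. -/
theorem exists_eq_smul_one_add_smul_of_commute (hι : 3 ≤ Fintype.card ι) {v φ : ι → K}
    (hv : v ≠ 0) (hφ : φ ≠ 0) (hφv : φ ⬝ᵥ v = 0) (Y : Matrix ι ι K)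
    (hY : ∀ g : SpecialLinearGroup ι K, Commute g.1 (vecMulVec v φ) → Commute Y g.1) :
    ∃ l m : K, Y = l • 1 + m • vecMulVec v φ := by
  -- `Y` commutes with all `a ψ` such that `φ`, `ψ` vanish on `a` and `ψ` vanishes on `v`
  have key : ∀ a ψ : ι → K, φ ⬝ᵥ a = 0 → ψ ⬝ᵥ v = 0 → ψ ⬝ᵥ a = 0 →
      vecMulVec (Y *ᵥ a) ψ = vecMulVec a (ψ ᵥ* Y) := by
    intro a ψ h1 h2 h3
    have := hY (vecTransvection a ψ h3) (by
      simp [Commute, SemiconjBy, coe_vecTransvection, add_mul, mul_add, vecMulVec_mul_vecMulVec,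
        h1, h2])
    simpa [Commute, SemiconjBy, coe_vecTransvection, add_mul, mul_add, mul_vecMulVec,
      vecMulVec_mul] using this
  have exists_ne : ∀ u : ι → K, u ≠ 0 → ∃ i, u i ≠ 0 := fun u hu => Function.ne_iff.mp hu
  obtain ⟨i₀, hi₀⟩ := exists_ne v hv
  obtain ⟨l, hl⟩ : ∃ l : K, Y *ᵥ v = l • v := by
    obtain ⟨ψ, hψ, h1, -⟩ := exists_ne_zero_dotProduct_pair_eq_zero hι v v
    obtain ⟨j, hj⟩ := exists_ne ψ hψ
    refine ⟨(ψ ᵥ* Y) j / ψ j, funext fun i => ?_⟩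
    have := congrFun (congrFun (key v ψ hφv h1 h1) i) j
    simp only [vecMulVec_apply] at this
    rw [Pi.smul_apply, smul_eq_mul]
    field_simp
    linear_combination this
  have hψ : ∀ ψ : ι → K, ψ ⬝ᵥ v = 0 → ψ ᵥ* Y = l • ψ := by
    intro ψ h
    have h1 := key v ψ hφv h h
    rw [hl] at h1
    ext j
    have := congrFun (congrFun h1 i₀) j
    simp only [vecMulVec_apply, Pi.smul_apply, smul_eq_mul] at this ⊢
    exact mul_left_cancel₀ hi₀ (by linear_combination -this)
  have ha : ∀ a : ι → K, φ ⬝ᵥ a = 0 → Y *ᵥ a = l • a := by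
    intro a h
    obtain ⟨ψ, hψ0, h1, h2⟩ := exists_ne_zero_dotProduct_pair_eq_zero hι v a
    obtain ⟨j, hj⟩ := exists_ne ψ hψ0
    have h3 := key a ψ h h1 h2
    rw [hψ ψ h1] at h3
    ext i
    have := congrFun (congrFun h3 i) j
    simp only [vecMulVec_apply, Pi.smul_apply, smul_eq_mul] at this ⊢
    exact mul_right_cancel₀ hj (by linear_combination this)
  obtain ⟨k₀, hk₀⟩ := exists_ne φ hφ
  -- `φ w = 1`, so that every vector is congruent to a multiple of `w` modulo the kernel of `φ`
  let w : ι → K := Pi.single k₀ (φ k₀)⁻¹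
  have hw : φ ⬝ᵥ w = 1 := by simp [w, hk₀]
  let c : ι → K := Y *ᵥ w - l • w
  have hc : ∀ ψ : ι → K, ψ ⬝ᵥ v = 0 → ψ ⬝ᵥ c = 0 := by
    intro ψ h
    simp only [c, dotProduct_sub, dotProduct_mulVec, hψ ψ h, smul_dotProduct, dotProduct_smul,
      sub_self]
  have hcv : ∀ k, c k = c i₀ / v i₀ * v k := by
    intro k
    have := hc (Pi.single k (v i₀) - Pi.single i₀ (v k)) (by
      simp [sub_dotProduct]; ring)
    simp only [sub_dotProduct, single_dotProduct] at this
    field_simp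
    linear_combination this
  refine ⟨l, c i₀ / v i₀, ?_⟩
  refine ext_of_mulVec_single fun j => ?_
  have h1 := ha (Pi.single j 1 - φ j • w) (by
    rw [dotProduct_sub, dotProduct_smul, hw]; simp)
  rw [mulVec_sub, mulVec_smul] at h1
  have h2 : Y *ᵥ Pi.single j 1 = l • Pi.single j 1 + φ j • c := by
    rw [sub_eq_iff_eq_add.mp h1]; simp only [c]; module
  rw [h2]
  ext k
  simp only [Pi.add_apply, Pi.smul_apply, smul_eq_mul, hcv k, add_mulVec, smul_mulVec, one_mulVec,
    vecMulVec_mulVec]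
  simp
  ring

theorem coe_transvection_eq_vecMulVec {i j : ι} (hij : i ≠ j) (t : K) :
    (transvection hij t).1 = 1 + t • vecMulVec (Pi.single i 1) (Pi.single j 1) := by
  rw [transvection_coe, ← single_eq_single_vecMulVec_single, smul_single, smul_eq_mul, mul_one]

theorem exists_conj_transvection (hι : 3 ≤ Fintype.card ι) {i j k l : ι} (hij : i ≠ j)
    (hkl : k ≠ l) : ∃ g : SpecialLinearGroup ι K,
      ∀ t : K, g * transvection hij t * g⁻¹ = transvection hkl t := by
  obtain ⟨σ, hσi, hσj⟩ : ∃ σ : Equiv.Perm ι, σ k = i ∧ σ l = j := by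
    refine ⟨Equiv.swap (Equiv.swap k i l) j * Equiv.swap k i, ?_, ?_⟩
    · rw [Equiv.Perm.mul_apply, Equiv.swap_apply_left]
      refine Equiv.swap_apply_of_ne_of_ne (fun h => hkl ?_) hij
      exact (Equiv.swap k i).injective ((Equiv.swap_apply_left k i).trans h)
    · rw [Equiv.Perm.mul_apply, Equiv.swap_apply_left]
  obtain ⟨m, hm⟩ : ∃ m, m ∉ ({i, j} : Finset ι) := by
    by_contra! h
    have := Finset.card_le_card (fun x _ => h x : Finset.univ ⊆ ({i, j} : Finset ι))
    rw [Finset.card_univ] at this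
    exact absurd (this.trans Finset.card_le_two) (by omega)
  simp only [Finset.mem_insert, Finset.mem_singleton, not_or] at hm
  -- the permutation matrix of `σ⁻¹`, with one entry outside the two relevant columns multiplied by
  -- the sign of `σ` in order to get determinant one
  let d : ι → K := fun x => if x = m then ((Equiv.Perm.sign σ : ℤ) : K) else 1
  have hdet : ((diagonal d).submatrix σ id).det = 1 := by
    rw [det_permute, det_diagonal, Finset.prod_ite_eq' Finset.univ m, if_pos (Finset.mem_univ m)]
    rw [← Int.cast_mul, ← Units.val_mul, Int.units_mul_self]
    simp
  let g : SpecialLinearGroup ι K := ⟨_, hdet⟩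
  have hg : g.1 = (diagonal d).submatrix σ id := rfl
  refine ⟨g, fun t => mul_inv_eq_of_eq_mul (Subtype.ext ?_)⟩
  simp only [hg, Matrix.SpecialLinearGroup.coe_mul, transvection_coe, mul_add, add_mul, mul_one,
    one_mul]
  congr 1
  ext x y
  by_cases hx : x = k
  · subst hx
    by_cases hy : y = j
    · subst hy
      rw [mul_single_apply_same, single_mul_apply_same]
      simp [hσi, hσj, d, Ne.symm hm.1, Ne.symm hm.2]
    · rw [mul_single_apply_of_ne _ _ _ _ _ hy, single_mul_apply_same]
      simp [hσj, Ne.symm hy]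
  · rw [single_mul_apply_of_ne _ _ _ _ _ hx]
    by_cases hy : y = j
    · subst hy
      rw [mul_single_apply_same]
      have : σ x ≠ i := fun h => hx (σ.injective (h.trans hσi.symm))
      simp [this]
    · rw [mul_single_apply_of_ne _ _ _ _ _ hy]

theorem exists_conj_transvection_eq_mul (hι : 3 ≤ Fintype.card ι) {i j : ι} (hij : i ≠ j) {a : K}
    (ha : a ≠ 0) : ∃ g : SpecialLinearGroup ι K,
      ∀ t : K, g * transvection hij t * g⁻¹ = transvection hij (a * t) := by
  obtain ⟨m, hm⟩ : ∃ m, m ∉ ({i, j} : Finset ι) := by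
    by_contra! h
    have := Finset.card_le_card (fun x _ => h x : Finset.univ ⊆ ({i, j} : Finset ι))
    rw [Finset.card_univ] at this
    exact absurd (this.trans Finset.card_le_two) (by omega)
  simp only [Finset.mem_insert, Finset.mem_singleton, not_or] at hm
  refine ⟨diag2n (Ne.symm hm.1) a ha, fun t => mul_inv_eq_of_eq_mul (Subtype.ext ?_)⟩
  simp only [Matrix.SpecialLinearGroup.coe_mul, transvection_coe, mul_add, add_mul, mul_one,
    one_mul, diag2n_coe]
  congr 1
  ext x y
  simp only [diagonal_mul, mul_diagonal, single_apply]
  by_cases h : i = x ∧ j = y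
  · obtain ⟨rfl, rfl⟩ := h
    simp [hij.symm, Ne.symm hm.2]
  · simp [h]

theorem commute_transvection_iff {i j : ι}
    (hij : i ≠ j) (g : SpecialLinearGroup ι K) :
    Commute g (transvection hij 1) ↔
      Commute g.1 (vecMulVec (Pi.single i 1) (Pi.single j 1)) := by
  have h : Commute g (transvection hij 1) ↔ Commute g.1 (transvection hij (1 : K)).1 :=
    Subtype.ext_iff
  rw [h, coe_transvection_eq_vecMulVec, one_smul]
  simp [Commute, SemiconjBy, mul_add, add_mul]

/-- The double centralizer of an elementary matrix in the special linear group. -/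
theorem exists_eq_center_mul_transvection (hι : 3 ≤ Fintype.card ι) {i j : ι} (hij : i ≠ j)
    (y : SpecialLinearGroup ι K) (hy : ∀ x, Commute x (transvection hij 1) → Commute y x) :
    ∃ c ∈ Subgroup.center (SpecialLinearGroup ι K), ∃ t : K, y = c * transvection hij t := by
  let E : Matrix ι ι K := vecMulVec (Pi.single i 1) (Pi.single j 1)
  have hE0 : E ≠ 0 := by simp [E]
  have hEE : E * E = 0 := by simp [E, vecMulVec_mul_vecMulVec, hij.symm]
  obtain ⟨l, m, hlm⟩ := exists_eq_smul_one_add_smul_of_commute hι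
    (v := Pi.single i (1 : K)) (φ := Pi.single j 1) (by simp) (by simp) (by simp [hij]) y.1
    (fun x hx => Subtype.ext_iff.mp (hy x ((commute_transvection_iff hij x).mpr hx)))
  replace hlm : y.1 = l • 1 + m • E := hlm
  have hl : l ≠ 0 := by
    rintro rfl
    rw [zero_smul, zero_add] at hlm
    apply hE0
    have h1 : y⁻¹.1 * (y.1 * E) = 0 := by
      rw [hlm, Matrix.smul_mul, hEE, smul_zero, mul_zero]
    rwa [← mul_assoc, ← Matrix.SpecialLinearGroup.coe_mul, inv_mul_cancel,
      Matrix.SpecialLinearGroup.coe_one, one_mul] at h1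
  refine ⟨y * transvection hij (-(m / l)), ?_, m / l, ?_⟩
  · have h1 : (y * transvection hij (-(m / l))).1 = l • 1 := by
      rw [Matrix.SpecialLinearGroup.coe_mul, hlm, coe_transvection_eq_vecMulVec]
      change (l • 1 + m • E) * (1 + (-(m / l)) • E) = _
      simp only [add_mul, mul_add, Matrix.smul_mul, Matrix.mul_smul, hEE, one_mul, mul_one,
        smul_zero, add_zero, smul_smul]
      rw [neg_mul, div_mul_cancel₀ _ hl, neg_smul, add_neg_cancel_right]
    refine Subgroup.mem_center_iff.mpr fun x => Subtype.ext ?_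
    change x.1 * (y * transvection hij (-(m / l))).1 = (y * transvection hij (-(m / l))).1 * x.1
    rw [h1, Matrix.mul_smul, Matrix.smul_mul, one_mul, mul_one]
  · rw [mul_assoc, ← transvection_add, neg_add_cancel, transvection_coeff_zero, mul_one]

end Transvections

/-! ### Unipotence of central commutators -/

section Unipotent

open Polynomial

theorem isNilpotent_aeval_of_forall_hasEigenvalue {k V : Type*} [Field k] [IsAlgClosed k]
    [AddCommGroup V] [Module k V] [FiniteDimensional k V] (T : Module.End k V) (q : k[X])
    (hq : ∀ μ, T.HasEigenvalue μ → q.eval μ = 0) : IsNilpotent (aeval T q) := by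
  have hm : (minpoly k T).Monic := minpoly.monic (Algebra.IsIntegral.isIntegral T)
  have hprod := (IsAlgClosed.splits (minpoly k T)).eq_prod_roots_of_monic hm
  have hdvd : minpoly k T ∣ q ^ (minpoly k T).roots.card := by
    rw [← Multiset.prod_replicate, ← Multiset.map_const']
    conv_lhs => rw [hprod]
    refine Multiset.prod_dvd_prod_of_dvd _ _ fun a ha => ?_
    rw [dvd_iff_isRoot]
    exact hq a (Module.End.hasEigenvalue_of_isRoot (isRoot_of_mem_roots ha))
  refine ⟨(minpoly k T).roots.card, ?_⟩
  rw [← map_pow]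
  exact (minpoly.dvd_iff).mp hdvd

/-- If `x z y = y z` where `y`, `z` are invertible endomorphisms commuting with `x`, then comparing
determinants on an eigenspace of `x` shows that all eigenvalues of `x` are roots of unity of order
at most the dimension. -/
theorem Module.End.HasEigenvalue.pow_factorial_eq_one {k V : Type*} [Field k] [AddCommGroup V]
    [Module k V] [FiniteDimensional k V] {x y z : Module.End k V} (hy : Function.Injective y)
    (hz : Function.Injective z) (hxy : Commute x y) (hxz : Commute x z)
    (h : x * (z * y) = y * z) {μ : k} (hμ : x.HasEigenvalue μ) :
    μ ^ (Module.finrank k V).factorial = 1 := by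
  have hyE : ∀ v ∈ x.eigenspace μ, y v ∈ x.eigenspace μ := fun v hv => by
    rw [Module.End.mem_eigenspace_iff] at hv ⊢
    rw [← Module.End.mul_apply, hxy.eq, Module.End.mul_apply, hv, map_smul]
  have hzE : ∀ v ∈ x.eigenspace μ, z v ∈ x.eigenspace μ := fun v hv => by
    rw [Module.End.mem_eigenspace_iff] at hv ⊢
    rw [← Module.End.mul_apply, hxz.eq, Module.End.mul_apply, hv, map_smul]
  have hrel : μ • (z.restrict hzE ∘ₗ y.restrict hyE) = y.restrict hyE ∘ₗ z.restrict hzE := by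
    ext v
    have h1 : x (z (y v)) = y (z v) := congrArg (fun f : Module.End k V => f v) h
    have h2 := Module.End.mem_eigenspace_iff.mp (hzE _ (hyE _ v.2))
    simpa [h2] using h1
  have hdet := congrArg LinearMap.det hrel
  rw [LinearMap.det_smul, LinearMap.det_comp, LinearMap.det_comp, mul_comm (LinearMap.det
    (y.restrict hyE))] at hdet
  have hne : ∀ {f : Module.End k V} (hf : Function.Injective f)
      (hfE : ∀ v ∈ x.eigenspace μ, f v ∈ x.eigenspace μ), LinearMap.det (f.restrict hfE) ≠ 0 := by
    intro f hf hfE h0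
    have := LinearMap.bot_lt_ker_of_det_eq_zero h0
    refine this.ne' (LinearMap.ker_eq_bot.mpr fun a b hab => Subtype.ext (hf ?_))
    exact congrArg Subtype.val hab
  have h1 : μ ^ Module.finrank k (x.eigenspace μ) = 1 :=
    mul_right_cancel₀ (mul_ne_zero (hne hz hzE) (hne hy hyE)) (by rw [hdet, one_mul])
  have hpos : 0 < Module.finrank k (x.eigenspace μ) := by
    rw [Module.finrank_pos_iff, Submodule.nontrivial_iff_ne_bot]
    exact hμ
  obtain ⟨c, hc⟩ := Nat.dvd_factorial hpos (Submodule.finrank_le (x.eigenspace μ))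
  rw [hc, pow_mul, h1, one_pow]

open scoped commutatorElement in
/-- A commutator that commutes with both of its entries has a unipotent power: its eigenvalues over
the algebraic closure are roots of unity of bounded order. -/
theorem isNilpotent_commutator_pow_factorial_sub_one {ι K : Type*} [Fintype ι] [DecidableEq ι]
    [Field K] {x y z : Matrix.SpecialLinearGroup ι K} (h : x = ⁅y, z⁆) (hxy : Commute x y)
    (hxz : Commute x z) : IsNilpotent (x.1 ^ (Fintype.card ι).factorial - 1) := by
  let A := AlgebraicClosure K
  let f : Matrix ι ι K →+* Module.End A (ι → A) :=
    (Matrix.toLinAlgEquiv' : Matrix ι ι A ≃ₐ[A] _).toRingEquiv.toRingHom.comp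
      (algebraMap K A).mapMatrix
  have hf : Function.Injective f :=
    (Matrix.toLinAlgEquiv' : Matrix ι ι A ≃ₐ[A] _).injective.comp
      (Matrix.map_injective (algebraMap K A).injective)
  let ρ : Matrix.SpecialLinearGroup ι K →* Module.End A (ι → A) :=
    f.toMonoidHom.comp Matrix.SpecialLinearGroup.coeMonoidHom
  have hinj : ∀ g, Function.Injective (ρ g) := fun g => by
    have : Function.LeftInverse (ρ g⁻¹) (ρ g) := fun v => by
      rw [← Module.End.mul_apply, ← map_mul, inv_mul_cancel, map_one, Module.End.one_apply]
    exact this.injective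
  rw [← IsNilpotent.map_iff hf]
  have hX : f (x.1 ^ (Fintype.card ι).factorial - 1) =
      aeval (ρ x) (X ^ (Fintype.card ι).factorial - 1 : A[X]) := by
    simp [ρ, Matrix.SpecialLinearGroup.coeMonoidHom_apply]
  rw [hX]
  refine isNilpotent_aeval_of_forall_hasEigenvalue _ _ fun μ hμ => ?_
  have := hμ.pow_factorial_eq_one (hinj y) (hinj z) (hxy.map ρ) (hxz.map ρ) (by
    rw [← map_mul, ← map_mul, ← map_mul, h, commutatorElement_def]; group)
  rw [Module.finrank_fintype_fun_eq_card] at this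
  simp [this]

end Unipotent

/-! ### Images of the unitriangular group -/

section Flag

open scoped commutatorElement

variable {Γ F V : Type*} [Group Γ] [Field F] [AddCommGroup V] [Module F V]

/-- The ascending flag of a group `B` of automorphisms of `V`: each term consists of the vectors
that are fixed by `B` modulo the preceding one. -/
def fixedFlag (ρ : Γ →* Module.End F V) (B : Subgroup Γ) : ℕ → Submodule F V
  | 0 => ⊥
  | k + 1 => ⨅ g ∈ B, (fixedFlag ρ B k).comap (ρ g - 1)

variable {ρ : Γ →* Module.End F V} {B : Subgroup Γ}

theorem mem_fixedFlag_succ {k : ℕ} {v : V} :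
    v ∈ fixedFlag ρ B (k + 1) ↔ ∀ g ∈ B, ρ g v - v ∈ fixedFlag ρ B k := by
  simp [fixedFlag]

theorem apply_mem_fixedFlag {k : ℕ} {v : V} (hv : v ∈ fixedFlag ρ B k) {g : Γ} (hg : g ∈ B) :
    ρ g v ∈ fixedFlag ρ B k := by
  cases k with
  | zero =>
    rw [fixedFlag, Submodule.mem_bot] at hv ⊢
    rw [hv, map_zero]
  | succ k =>
    rw [mem_fixedFlag_succ] at hv ⊢
    intro h hh
    have := (fixedFlag ρ B k).sub_mem (hv _ (B.mul_mem hh hg)) (hv _ hg)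
    rwa [map_mul, Module.End.mul_apply, sub_sub_sub_cancel_right] at this

theorem fixedFlag_mono : Monotone (fixedFlag ρ B) :=
  monotone_nat_of_le_succ fun _ _ hv => mem_fixedFlag_succ.mpr fun _ hg =>
    Submodule.sub_mem _ (apply_mem_fixedFlag hv hg) hv

/-- If each proper invariant subspace can be enlarged by a vector fixed modulo it, then the flag
grows until it reaches the whole space. -/
theorem le_finrank_fixedFlag [FiniteDimensional F V]
    (hfix : ∀ P : Submodule F V, P ≠ ⊤ → (∀ g ∈ B, ∀ v ∈ P, ρ g v ∈ P) →
      ∃ v ∉ P, ∀ g ∈ B, ρ g v - v ∈ P) {k : ℕ} (hk : k ≤ Module.finrank F V) :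
    k ≤ Module.finrank F (fixedFlag ρ B k) := by
  induction k with
  | zero => exact Nat.zero_le _
  | succ k ih =>
    by_cases htop : fixedFlag ρ B k = ⊤
    · have : fixedFlag ρ B (k + 1) = ⊤ := top_le_iff.mp (htop ▸ fixedFlag_mono k.le_succ)
      rwa [this, finrank_top]
    · obtain ⟨v, hv, hfv⟩ := hfix _ htop fun g hg v hv => apply_mem_fixedFlag hv hg
      exact (ih (k.le_succ.trans hk)).trans_lt (Submodule.finrank_lt_finrank_of_lt
        (lt_of_le_of_ne (fixedFlag_mono k.le_succ) fun h =>
          hv (h ▸ mem_fixedFlag_succ.mpr hfv)))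

/-- An element `g` of `B` has depth `m` if `g - 1` lowers the terms of the flag by `m` steps. -/
def HasFlagDepth (ρ : Γ →* Module.End F V) (B : Subgroup Γ) (m : ℕ) (g : Γ) : Prop :=
  g ∈ B ∧ ∀ k, ∀ v ∈ fixedFlag ρ B (k + m), ρ g v - v ∈ fixedFlag ρ B k

theorem hasFlagDepth_one {g : Γ} (hg : g ∈ B) : HasFlagDepth ρ B 1 g :=
  ⟨hg, fun _ _ hv => mem_fixedFlag_succ.mp hv g hg⟩

theorem HasFlagDepth.commutator {a b : ℕ} {g h : Γ} (hg : HasFlagDepth ρ B a g)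
    (hh : HasFlagDepth ρ B b h) : HasFlagDepth ρ B (a + b) ⁅g, h⁆ := by
  refine ⟨B.mul_mem (B.mul_mem (B.mul_mem hg.1 hh.1) (B.inv_mem hg.1)) (B.inv_mem hh.1),
    fun k v hv => ?_⟩
  let w := ρ (g⁻¹ * h⁻¹) v
  have hw : w ∈ fixedFlag ρ B (k + (a + b)) :=
    apply_mem_fixedFlag hv (B.mul_mem (B.inv_mem hg.1) (B.inv_mem hh.1))
  have h1 : ρ ⁅g, h⁆ v = ρ g (ρ h w) := by
    simp only [w, ← Module.End.mul_apply, ← map_mul]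
    rw [commutatorElement_def]; congr 2; group
  have h2 : v = ρ h (ρ g w) := by
    simp only [w, ← Module.End.mul_apply, ← map_mul]
    simp
  have h3 : ρ ⁅g, h⁆ v - v = (ρ g (ρ h w - w) - (ρ h w - w)) -
      (ρ h (ρ g w - w) - (ρ g w - w)) := by
    rw [h1]
    conv_lhs => rw [h2]
    simp only [map_sub]
    abel
  rw [h3]
  refine Submodule.sub_mem _ (hg.2 _ _ (hh.2 _ _ ?_)) (hh.2 _ _ (hg.2 _ _ ?_))
  · rwa [add_assoc]
  · rwa [add_assoc, add_comm b a]

end Flag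

section Kolchin

open Matrix Matrix.SpecialLinearGroup
open scoped commutatorElement

variable {L F V : Type*} [Field L] [Field F] [AddCommGroup V] [Module F V] {n : ℕ}

variable (L n) in
/-- The group generated by the upper unitriangular elementary matrices with entry `1`. It takes the
place of the group of all unitriangular matrices. -/
def unitriangular : Subgroup (SpecialLinearGroup (Fin n) L) :=
  Subgroup.closure {g | ∃ (i j : Fin n) (h : i < j), g = transvection h.ne 1}

theorem transvection_mem_unitriangular {i j : Fin n} (h : i < j) :
    transvection h.ne (1 : L) ∈ unitriangular L n :=
  Subgroup.subset_closure ⟨i, j, h, rfl⟩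

/-- A form of Kolchin's theorem for the unitriangular group: if all elementary matrices act
unipotently, then every proper invariant subspace `P` can be enlarged by a vector that is fixed
modulo `P`. Such a vector is found by treating the elementary matrices one after the other in the
order of decreasing distance from the diagonal, so that each of them normalizes the group generated
by the preceding ones. -/
theorem exists_notMem_fixed_unitriangular {ρ : SpecialLinearGroup (Fin n) L →* Module.End F V}
    (hρ : ∀ (i j : Fin n) (h : i < j), IsNilpotent (ρ (transvection h.ne 1) - 1))
    {P : Submodule F V} (hP : P ≠ ⊤) (hinv : ∀ g ∈ unitriangular L n, ∀ v ∈ P, ρ g v ∈ P) :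
    ∃ v ∉ P, ∀ g ∈ unitriangular L n, ρ g v - v ∈ P := by
  classical
  let f : Fin n × Fin n → ℤ := fun r => (r.1 : ℤ) - r.2
  have hfix_inv : ∀ {g : SpecialLinearGroup (Fin n) L} {v : V}, g ∈ unitriangular L n →
      ρ g v - v ∈ P → ρ g⁻¹ v - v ∈ P := fun {g v} hg hv => by
    have := P.neg_mem (hinv _ (inv_mem hg) _ hv)
    rwa [map_sub, ← Module.End.mul_apply, ← map_mul, inv_mul_cancel, map_one,
      Module.End.one_apply, neg_sub] at this
  have hfix_mul : ∀ {g h : SpecialLinearGroup (Fin n) L} {v : V}, g ∈ unitriangular L n →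
      ρ g v - v ∈ P → ρ h v - v ∈ P → ρ (g * h) v - v ∈ P := fun {g h v} hg hv hv' => by
    have := P.add_mem (hinv _ hg _ hv') hv
    rwa [map_sub, ← Module.End.mul_apply, ← map_mul, sub_add_sub_cancel] at this
  have key : ∀ s : Finset (Fin n × Fin n), (∀ a ∈ s, ∀ b, f b < f a → b ∈ s) →
      ∃ v ∉ P, ∀ (i j : Fin n) (h : i < j), (i, j) ∈ s → ρ (transvection h.ne 1) v - v ∈ P := by
    intro s
    induction s using Finset.induction_on_max_value f with
    | empty =>
      intro _
      obtain ⟨v, -, hv⟩ := SetLike.exists_of_lt (lt_top_iff_ne_top.mpr hP)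
      exact ⟨v, hv, by simp⟩
    | insert a s has hmax ih =>
      intro hup
      have hs : ∀ c, f c < f a → c ∈ s := fun c hc => by
        rcases Finset.mem_insert.mp (hup a (Finset.mem_insert_self a s) c hc) with rfl | h
        · exact absurd hc (lt_irrefl _)
        · exact h
      obtain ⟨v, hvP, hv⟩ := ih fun c hc b hb => hs b (hb.trans_le (hmax c hc))
      obtain ⟨k, l⟩ := a
      by_cases hkl : k < l
      swap
      · refine ⟨v, hvP, fun i j hij hmem => ?_⟩
        rcases Finset.mem_insert.mp hmem with h | h
        · simp only [Prod.mk.injEq] at h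
          exact absurd (h.1 ▸ h.2 ▸ hij) hkl
        · exact hv i j hij h
      let x : SpecialLinearGroup (Fin n) L := transvection hkl.ne 1
      have hxB : x ∈ unitriangular L n := transvection_mem_unitriangular hkl
      -- the vectors fixed modulo `P` by the matrices treated so far form an `x`-invariant set
      have hW : ∀ w : V, (∀ (i j : Fin n) (h : i < j), (i, j) ∈ s →
          ρ (transvection h.ne 1) w - w ∈ P) → ∀ (i j : Fin n) (h : i < j), (i, j) ∈ s →
          ρ (transvection h.ne 1) ((ρ x - 1) w) - (ρ x - 1) w ∈ P := by
        intro w hw i j hij hmem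
        let r : SpecialLinearGroup (Fin n) L := transvection hij.ne 1
        have hrB : r ∈ unitriangular L n := transvection_mem_unitriangular hij
        have hc : ρ ⁅r⁻¹, x⁻¹⁆ w - w ∈ P := by
          simp only [r, x, transvection_inv]
          by_cases hjk : j = k
          · subst hjk
            rw [commutator_transvection hij.ne hkl.ne (hij.trans hkl).ne]
            have := hw i l (hij.trans hkl) (hs _ (by
              simp only [f, sub_lt_sub_iff_right]; exact_mod_cast hij))
            simpa using this
          by_cases hli : l = i
          · subst hli
            rw [← commutatorElement_inv, commutator_transvection hkl.ne hij.ne (hkl.trans hij).ne,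
              neg_mul_neg, one_mul]
            refine hfix_inv (transvection_mem_unitriangular (hkl.trans hij))
              (hw k j (hkl.trans hij) (hs _ ?_))
            have : (l : ℤ) < j := by exact_mod_cast hij
            simp only [f]
            omega
          rw [commutatorElement_eq_one_iff_commute.mpr (commute_transvection _ _ hjk hli _ _)]
          simp
        have hrx : r * x = x * (r * ⁅r⁻¹, x⁻¹⁆) := by rw [commutatorElement_def]; group
        have h1 : ρ (r * x) w - ρ x w ∈ P := by
          have h2 := hinv x hxB _ (hfix_mul hrB (hw i j hij hmem) hc)
          rwa [map_sub, ← Module.End.mul_apply, ← map_mul, ← hrx] at h2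
        have h3 := P.sub_mem h1 (hw i j hij hmem)
        rw [map_mul, Module.End.mul_apply] at h3
        have h4 : ρ r ((ρ x - 1) w) - (ρ x - 1) w = ρ r (ρ x w) - ρ x w - (ρ r w - w) := by
          simp only [LinearMap.sub_apply, Module.End.one_apply, map_sub]; abel
        rw [h4]
        exact h3
      let T : Module.End F V := ρ x - 1
      have hWpow : ∀ m, ∀ (i j : Fin n) (h : i < j), (i, j) ∈ s →
          ρ (transvection h.ne 1) ((T ^ m) v) - (T ^ m) v ∈ P := by
        intro m
        induction m with
        | zero => simpa using hv
        | succ m ihm => rw [pow_succ']; exact hW _ ihm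
      have hex : ∃ m, (T ^ m) v ∈ P := by
        obtain ⟨m, hm⟩ := hρ k l hkl
        exact ⟨m, by rw [hm]; exact P.zero_mem⟩
      have hne : Nat.find hex ≠ 0 := fun h => hvP (by simpa [h] using Nat.find_spec hex)
      obtain ⟨m, hm⟩ := Nat.exists_eq_succ_of_ne_zero hne
      refine ⟨(T ^ m) v, Nat.find_min hex (by omega), fun i j hij hmem => ?_⟩
      rcases Finset.mem_insert.mp hmem with h | h
      · simp only [Prod.mk.injEq] at h
        obtain ⟨rfl, rfl⟩ := h
        have := Nat.find_spec hex
        rw [hm, Nat.succ_eq_add_one, pow_succ'] at this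
        exact this
      · exact hWpow m i j hij h
  obtain ⟨v, hvP, hv⟩ := key Finset.univ fun _ _ _ _ => Finset.mem_univ _
  refine ⟨v, hvP, fun g hg => ?_⟩
  induction hg using Subgroup.closure_induction with
  | mem g hg =>
    obtain ⟨i, j, h, rfl⟩ := hg
    exact hv i j h (Finset.mem_univ _)
  | one => simp
  | mul g h hg hh ihg ihh => exact hfix_mul hg ihg ihh
  | inv g hg ihg => exact hfix_inv hg ihg

/-- The corner elementary matrix is a commutator of length `n - 1` of unitriangular matrices, so
that it lowers the flag by `n - 1` steps. -/
theorem hasFlagDepth_transvection (ρ : SpecialLinearGroup (Fin n) L →* Module.End F V)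
    (m : ℕ) (hm : m + 1 < n) :
    HasFlagDepth ρ (unitriangular L n) (m + 1)
      (transvection (i := (⟨0, by omega⟩ : Fin n)) (j := ⟨m + 1, hm⟩) (by simp) (1 : L)) := by
  induction m with
  | zero => exact hasFlagDepth_one (transvection_mem_unitriangular (by simp [Fin.lt_def]))
  | succ m ih =>
    have h := (ih (by omega)).commutator (hasFlagDepth_one (ρ := ρ)
      (transvection_mem_unitriangular (L := L) (i := (⟨m + 1, by omega⟩ : Fin n))
        (j := ⟨m + 1 + 1, hm⟩) (by simp [Fin.lt_def])))
    rwa [commutator_transvection _ _ (by simp), one_mul] at h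

/-- An injective homomorphism between special linear groups of the same degree that maps elementary
matrices to unipotent ones maps the corner elementary matrix to a transvection. -/
theorem exists_eq_one_add_vecMulVec (hn : 2 ≤ n)
    (θ : SpecialLinearGroup (Fin n) L →* SpecialLinearGroup (Fin n) F)
    (hθ : Function.Injective θ)
    (hu : ∀ (i j : Fin n) (h : i < j), IsNilpotent ((θ (transvection h.ne 1)).1 - 1))
    {i j : Fin n} (hij : i ≠ j) (hi : i.1 = 0) (hj : j.1 = n - 1) :
    ∃ v φ : Fin n → F, v ≠ 0 ∧ φ ≠ 0 ∧ φ ⬝ᵥ v = 0 ∧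
      (θ (transvection hij 1)).1 = 1 + vecMulVec v φ := by
  obtain ⟨m, rfl⟩ : ∃ m, n = m + 2 := ⟨n - 2, by omega⟩
  obtain rfl : i = ⟨0, Nat.succ_pos _⟩ := Fin.ext hi
  obtain rfl : j = ⟨m + 1, Nat.lt_succ_self _⟩ := Fin.ext hj
  let τ : Matrix (Fin (m + 2)) (Fin (m + 2)) F →+* Module.End F (Fin (m + 2) → F) :=
    (Matrix.toLinAlgEquiv' : Matrix (Fin (m + 2)) (Fin (m + 2)) F ≃ₐ[F] _).toRingEquiv.toRingHom
  let ρ : SpecialLinearGroup (Fin (m + 2)) L →* Module.End F (Fin (m + 2) → F) :=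
    (τ.toMonoidHom.comp coeMonoidHom).comp θ
  have hρτ : ∀ g, ρ g = τ (θ g).1 := fun _ => rfl
  have hτ : ∀ (M : Matrix (Fin (m + 2)) (Fin (m + 2)) F) v, τ M v = M *ᵥ v := fun _ _ => rfl
  have hfix : ∀ P : Submodule F (Fin (m + 2) → F), P ≠ ⊤ →
      (∀ g ∈ unitriangular L (m + 2), ∀ v ∈ P, ρ g v ∈ P) →
      ∃ v ∉ P, ∀ g ∈ unitriangular L (m + 2), ρ g v - v ∈ P := fun P hP hinv =>
    exists_notMem_fixed_unitriangular (fun a b h => by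
      have := (hu a b h).map τ
      rwa [map_sub, map_one] at this) hP hinv
  have hd : Module.finrank F (Fin (m + 2) → F) = m + 2 := by simp
  have hdep := (hasFlagDepth_transvection ρ m (by omega)).2
  set u := transvection hij (1 : L) with hu_def
  let N := (θ u).1 - 1
  have hN : ∀ k, ∀ v ∈ fixedFlag ρ (unitriangular L (m + 2)) (k + (m + 1)),
      N *ᵥ v ∈ fixedFlag ρ (unitriangular L (m + 2)) k := fun k v hv => by
    have := hdep k v hv
    rwa [hρτ, hτ, ← one_mulVec v, mulVec_mulVec, mul_one, ← sub_mulVec] at this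
  have htop : fixedFlag ρ (unitriangular L (m + 2)) (1 + (m + 1)) = ⊤ := by
    refine Submodule.eq_top_of_finrank_eq (le_antisymm (Submodule.finrank_le _) ?_)
    have := le_finrank_fixedFlag hfix (k := 1 + (m + 1)) (by rw [hd]; omega)
    rw [hd]; omega
  have hker : ∀ v ∈ fixedFlag ρ (unitriangular L (m + 2)) (m + 1), N *ᵥ v = 0 := fun v hv => by
    have := hN 0 v (by rwa [zero_add])
    rwa [fixedFlag, Submodule.mem_bot] at this
  have hNN : N * N = 0 := by
    refine ext_of_mulVec_single fun k => ?_
    rw [← mulVec_mulVec, zero_mulVec]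
    exact hker _ (fixedFlag_mono (by omega) (hN 1 _ (htop ▸ Submodule.mem_top)))
  have hrange : Module.finrank F (LinearMap.range N.mulVecLin) ≤ 1 := by
    have h1 := LinearMap.finrank_range_add_finrank_ker N.mulVecLin
    have h2 : m + 1 ≤ Module.finrank F (LinearMap.ker N.mulVecLin) :=
      (le_finrank_fixedFlag hfix (k := m + 1) (by rw [hd]; omega)).trans
        (Submodule.finrank_mono fun v hv => by simpa using hker v hv)
    omega
  obtain ⟨⟨v, hv⟩, hvspan⟩ := finrank_le_one_iff.mp hrange
  choose φ hφ using fun k : Fin (m + 2) =>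
    hvspan ⟨N *ᵥ Pi.single k 1, Pi.single k 1, rfl⟩
  have hNv : N = vecMulVec v φ := by
    refine ext_of_mulVec_single fun k => ?_
    have hk : φ k • v = N *ᵥ Pi.single k 1 := congrArg Subtype.val (hφ k)
    rw [← hk]
    ext x
    simp [vecMulVec_apply, mul_comm]
  have hN0 : N ≠ 0 := fun h => by
    have h1 : θ u = 1 := Subtype.ext (sub_eq_zero.mp h)
    rw [← map_one θ] at h1
    have h2 := hθ h1
    rw [hu_def, ← transvection_coeff_zero hij] at h2
    exact one_ne_zero (transvection_injective hij h2)
  rw [hNv, Ne, vecMulVec_eq_zero, not_or] at hN0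
  refine ⟨v, φ, hN0.1, hN0.2, ?_, by rw [← hNv]; simp [N]⟩
  rw [hNv, vecMulVec_mul_vecMulVec, vecMulVec_eq_zero, or_iff_right hN0.1, smul_eq_zero,
    or_iff_left hN0.2] at hNN
  exact hNN

end Kolchin

/-! ### Isomorphisms of special linear groups -/

section Isomorphism

open Matrix Matrix.SpecialLinearGroup
open scoped commutatorElement

variable {L F : Type*} [Field L] [Field F] {n : ℕ}

/-- Elementary matrices are mapped to unipotent ones: in characteristic `p` because they have order
`p`, otherwise because they have an `n!`-th root that is a central commutator of a Heisenberg
group. -/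
theorem isNilpotent_map_transvection_sub_one (hn : 3 ≤ n)
    (θ : SpecialLinearGroup (Fin n) L →* SpecialLinearGroup (Fin n) F)
    (hchar : (ringChar F : L) = 0) (hfact : ringChar F = 0 → (n.factorial : L) ≠ 0)
    {i j : Fin n} (hij : i ≠ j) : IsNilpotent ((θ (transvection hij 1)).1 - 1) := by
  by_cases h0 : ringChar F = 0
  · obtain ⟨k, hk⟩ : ∃ k, k ∉ ({i, j} : Finset (Fin n)) := by
      by_contra! h
      have := Finset.card_le_card (fun x _ => h x : Finset.univ ⊆ ({i, j} : Finset (Fin n)))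
      rw [Finset.card_univ, Fintype.card_fin] at this
      exact absurd (this.trans Finset.card_le_two) (by omega)
    simp only [Finset.mem_insert, Finset.mem_singleton, not_or] at hk
    let c : L := (n.factorial : L)⁻¹
    have hcomm := commutator_transvection (Ne.symm hk.1) hk.2 hij c (1 : L)
    have hpow : transvection hij (1 : L) = transvection hij (c * 1) ^ n.factorial := by
      rw [transvection_pow, mul_one, mul_inv_cancel₀ (hfact h0)]
    have := isNilpotent_commutator_pow_factorial_sub_one
      (x := θ (transvection hij (c * 1))) (y := θ (transvection (Ne.symm hk.1) c))
      (z := θ (transvection hk.2 1)) (by rw [← map_commutatorElement, hcomm])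
      ((commute_transvection hij (Ne.symm hk.1) hij.symm hk.1 _ _).map θ)
      ((commute_transvection hij hk.2 (Ne.symm hk.2) hij.symm _ _).map θ)
    rw [Fintype.card_fin] at this
    rwa [hpow, map_pow, Matrix.SpecialLinearGroup.coe_pow]
  · have hp : (ringChar F).Prime := (CharP.char_is_prime_or_zero F (ringChar F)).resolve_right h0
    have : Fact (ringChar F).Prime := ⟨hp⟩
    have : Nonempty (Fin n) := ⟨⟨0, by omega⟩⟩
    refine ⟨ringChar F, ?_⟩
    rw [sub_pow_char_of_commute (ringChar F) (Commute.one_right _),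
      ← Matrix.SpecialLinearGroup.coe_pow, ← map_pow, transvection_pow, hchar, zero_mul,
      transvection_coeff_zero, map_one, one_pow, Matrix.SpecialLinearGroup.coe_one, sub_self]

/-- A group isomorphism between special linear groups of degree at least three yields an isomorphism
of the fields. The corner elementary matrix is mapped to a transvection `1 + N`; comparing double
centralizers, the matrix with corner entry `t` is mapped to `1 + f t • N`, and `f` is the
isomorphism. Multiplication is recovered from the action of the diagonal matrices. -/
theorem nonempty_ringEquiv_of_mulEquiv_specialLinearGroup (hn : 3 ≤ n)
    (θ : SpecialLinearGroup (Fin n) L ≃* SpecialLinearGroup (Fin n) F)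
    (hchar : (ringChar F : L) = 0) (hfact : ringChar F = 0 → (n.factorial : L) ≠ 0) :
    Nonempty (L ≃+* F) := by
  have hcard : 3 ≤ Fintype.card (Fin n) := by rwa [Fintype.card_fin]
  let i : Fin n := ⟨0, by omega⟩
  let j : Fin n := ⟨n - 1, by omega⟩
  have hij : i ≠ j := fun h => by
    have := congrArg Fin.val h
    simp only [i, j] at this
    omega
  obtain ⟨v, φ, hv, hφ, hφv, hN⟩ := exists_eq_one_add_vecMulVec (by omega) θ.toMonoidHom
    θ.injective (fun a b h => isNilpotent_map_transvection_sub_one hn _ hchar hfact h.ne)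
    hij rfl rfl
  set N := vecMulVec v φ with hN_def
  replace hN : (θ (transvection hij 1)).1 = 1 + N := hN
  have hN0 : N ≠ 0 := by simp [hN_def, hv, hφ]
  have hNN : N * N = 0 := by rw [hN_def, vecMulVec_mul_vecMulVec, hφv, zero_smul, vecMulVec_zero]
  have hcomm : ∀ g : SpecialLinearGroup (Fin n) F,
      Commute g (θ (transvection hij 1)) ↔ Commute g.1 N := fun g => by
    have h : Commute g (θ (transvection hij 1)) ↔ Commute g.1 (θ (transvection hij 1)).1 :=
      Subtype.ext_iff
    rw [h, hN]
    simp [Commute, SemiconjBy, mul_add, add_mul]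
  have hconj : ∀ (d x : SpecialLinearGroup (Fin n) L) (c : F) (Q : Matrix (Fin n) (Fin n) F),
      (θ x).1 = 1 + c • Q →
      (θ (d * x * d⁻¹)).1 = 1 + c • ((θ d).1 * Q * (θ d⁻¹).1) := by
    intro d x c Q h
    rw [map_mul, map_mul, Matrix.SpecialLinearGroup.coe_mul, Matrix.SpecialLinearGroup.coe_mul, h,
      mul_add, add_mul, mul_one, ← Matrix.SpecialLinearGroup.coe_mul, ← map_mul, mul_inv_cancel,
      map_one, Matrix.SpecialLinearGroup.coe_one, Matrix.mul_smul, Matrix.smul_mul]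
  have hex : ∀ t : L, ∃ c : F, (θ (transvection hij t)).1 = 1 + c • N := by
    intro t
    rcases eq_or_ne t 0 with rfl | ht
    · exact ⟨0, by simp⟩
    obtain ⟨l, m, hlm⟩ := exists_eq_smul_one_add_smul_of_commute hcard hv hφ hφv
      (θ (transvection hij t)).1 (fun g hg => by
        have h1 := (((hcomm g).mpr hg).map θ.symm)
        rw [θ.symm_apply_apply, commute_transvection_iff] at h1
        have h2 : Commute (θ.symm g) (transvection hij t) := Subtype.ext (by
          change (θ.symm g).1 * _ = _ * (θ.symm g).1
          rw [coe_transvection_eq_vecMulVec]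
          exact (Commute.one_right _).add_right (h1.smul_right t))
        have h3 := h2.map θ
        rw [θ.apply_symm_apply] at h3
        exact (Subtype.ext_iff.mp h3).symm)
    obtain ⟨d, hd⟩ := exists_conj_transvection_eq_mul hcard hij ht
    -- the image is conjugate to `1 + N`, hence unipotent, so that its scalar part is `1`
    have h1 := hconj d _ 1 N (hN.trans (by rw [one_smul]))
    rw [hd, mul_one, one_smul] at h1
    have h2 : (θ d).1 * N * (θ d⁻¹).1 = (l - 1) • 1 + m • N := by
      rw [eq_sub_of_add_eq' h1.symm, hlm, sub_smul, one_smul, add_sub_right_comm]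
    have h3 : ((θ d).1 * N * (θ d⁻¹).1) * ((θ d).1 * N * (θ d⁻¹).1) = 0 := by
      have : (θ d⁻¹).1 * (θ d).1 = 1 := by
        rw [← Matrix.SpecialLinearGroup.coe_mul, ← map_mul, inv_mul_cancel, map_one,
          Matrix.SpecialLinearGroup.coe_one]
      rw [show ∀ A B C : Matrix (Fin n) (Fin n) F, (A * B * C) * (A * B * C) =
        A * (B * (C * A) * B) * C from fun A B C => by noncomm_ring, this, mul_one, hNN, mul_zero,
        zero_mul]
    have h4 : ((l - 1) * (l - 1)) • N = 0 := by
      rw [h2] at h3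
      have := congrArg (· * N) h3
      simpa [add_mul, mul_add, mul_assoc, hNN, smul_smul] using this
    have h5 : l = 1 := by
      rw [smul_eq_zero, or_iff_left hN0, mul_self_eq_zero] at h4
      exact sub_eq_zero.mp h4
    exact ⟨m, by rw [hlm, h5, one_smul]⟩
  choose f hf using hex
  have huniq : ∀ a b : F, 1 + a • N = 1 + b • N → a = b := fun a b h =>
    smul_left_injective F hN0 (add_left_cancel h)
  have hmulN : ∀ a b : F, (1 + a • N) * (1 + b • N) = 1 + (a + b) • N := fun a b => by
    simp only [add_mul, mul_add, Matrix.smul_mul, Matrix.mul_smul, hNN, one_mul, mul_one,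
      smul_zero, add_zero, add_smul, add_assoc]
  have hadd : ∀ s t, f (s + t) = f s + f t := fun s t => huniq _ _ <| by
    rw [← hf, transvection_add, map_mul, Matrix.SpecialLinearGroup.coe_mul, hf, hf, hmulN]
  have hone : f 1 = 1 := huniq _ _ (by rw [← hf, hN, one_smul])
  have hzero : f 0 = 0 := by simpa using hadd 0 0
  have hmul : ∀ s t, f (s * t) = f s * f t := by
    intro s t
    rcases eq_or_ne s 0 with rfl | hs
    · rw [zero_mul, hzero, zero_mul]
    obtain ⟨d, hd⟩ := exists_conj_transvection_eq_mul hcard hij hs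
    have h1 := hconj d _ 1 N (hN.trans (by rw [one_smul]))
    rw [hd, mul_one, one_smul, hf] at h1
    have h2 := hconj d _ _ N (hf t)
    rw [hd, hf, ← add_left_cancel h1, smul_smul, mul_comm (f t)] at h2
    exact huniq _ _ h2
  let fr : L →+* F :=
    { toFun := f, map_one' := hone, map_mul' := hmul, map_zero' := hzero, map_add' := hadd }
  refine ⟨RingEquiv.ofBijective fr ⟨fr.injective, fun s => ?_⟩⟩
  let g : SpecialLinearGroup (Fin n) F := vecTransvection (s • v) φ (by
    rw [dotProduct_smul, hφv, smul_zero])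
  have hg : g.1 = 1 + s • N := by rw [coe_vecTransvection, smul_vecMulVec]
  obtain ⟨c, hc, t, hct⟩ := exists_eq_center_mul_transvection hcard hij (θ.symm g) fun x hx => by
    have h1 := (hcomm _).mp (hx.map θ)
    have h2 : Commute (θ x) g := Subtype.ext (by
      change (θ x).1 * g.1 = g.1 * (θ x).1
      rw [hg]
      exact (Commute.one_right _).add_right (h1.smul_right s))
    have h3 := h2.map θ.symm
    rw [θ.symm_apply_apply] at h3
    exact h3.symm
  have hθc : θ c ∈ Subgroup.center _ := by
    refine Subgroup.mem_center_iff.mpr fun x => ?_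
    have := congrArg θ (Subgroup.mem_center_iff.mp hc (θ.symm x))
    simpa using this
  obtain ⟨ζ, -, hζ⟩ := Matrix.SpecialLinearGroup.mem_center_iff.mp hθc
  have hgt : 1 + s • N = ζ • (1 + f t • N) := by
    rw [← hg, ← hf, ← θ.apply_symm_apply g, hct, map_mul, Matrix.SpecialLinearGroup.coe_mul, ← hζ,
      scalar_apply, ← smul_one_eq_diagonal, Matrix.smul_mul, one_mul]
  have hζ1 : ζ = 1 := by
    have := congrArg (· * N) hgt
    simp only [Matrix.smul_mul, one_mul, add_mul, hNN, smul_zero, add_zero] at this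
    exact smul_left_injective F hN0 (this.symm.trans (one_smul F N).symm)
  rw [hζ1, one_smul] at hgt
  exact ⟨t, huniq _ _ hgt.symm⟩

end Isomorphism

/-! ### Bounded generation by elementary matrices -/

section BoundedGeneration

open Matrix Matrix.SpecialLinearGroup
open scoped Pointwise

variable {K : Type*} [Field K] {n : ℕ}

variable (K n) in
/-- The set of elementary matrices. -/
def elementaryMatrices : Set (SpecialLinearGroup (Fin n) K) :=
  {g | ∃ (q : {q : Fin n × Fin n // q.1 ≠ q.2}) (t : K), g = transvection q.2 t}

theorem transvection_mem_elementaryMatrices {i j : Fin n} (h : i ≠ j) (t : K) :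
    transvection h t ∈ elementaryMatrices K n :=
  ⟨⟨(i, j), h⟩, t, rfl⟩

theorem one_mem_elementaryMatrices (hn : 2 ≤ n) : 1 ∈ elementaryMatrices K n := by
  have h : (⟨0, by omega⟩ : Fin n) ≠ ⟨1, by omega⟩ := by simp
  rw [← transvection_coeff_zero h]
  exact transvection_mem_elementaryMatrices h 0

/-- Subtracting multiples of row `k` clears column `k` in the rows of `T` if the diagonal entry is
`1`. -/
theorem exists_mem_pow_mul_apply (M : SpecialLinearGroup (Fin n) K) {k : Fin n}
    (T : Finset (Fin n)) (hT : k ∉ T) :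
    ∃ a ∈ elementaryMatrices K n ^ T.card, ∀ i j,
      (a * M) i j = if i ∈ T then M i j - M i k * M k j else M i j := by
  induction T using Finset.induction_on with
  | empty => exact ⟨1, by simp, by simp⟩
  | insert l T hl ih =>
    simp only [Finset.mem_insert, not_or] at hT
    obtain ⟨a, ha, haM⟩ := ih hT.2
    refine ⟨transvection (Ne.symm hT.1) (-(M l k)) * a, ?_, fun i j => ?_⟩
    · rw [Finset.card_insert_of_notMem hl, pow_succ']
      exact Set.mul_mem_mul (transvection_mem_elementaryMatrices _ _) ha
    · rw [mul_assoc]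
      change (Matrix.transvection l k (-(M l k)) * (a * M).1) i j = _
      by_cases hil : i = l
      · subst hil
        rw [transvection_mul_apply_same]
        change (a * M) i j + -(M i k) * (a * M) k j = _
        rw [haM, haM, if_neg hl, if_neg hT.2, if_pos (Finset.mem_insert_self _ _)]
        ring
      · rw [transvection_mul_apply_of_ne _ _ _ _ hil]
        refine (haM i j).trans ?_
        simp [hil]

/-- Row operations on the columns from the left: if the first `k` columns of `M` agree with those of
the identity, then `n + 1` row operations make the next column agree with it as well. -/
theorem exists_mem_pow_columns_succ (hn : 2 ≤ n) (M : SpecialLinearGroup (Fin n) K) (k : Fin n)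
    (hM : ∀ j, j < k → ∀ i, M i j = (1 : Matrix (Fin n) (Fin n) K) i j) :
    ∃ a ∈ elementaryMatrices K n ^ (n + 1), ∀ j, j ≤ k → ∀ i,
      (a * M) i j = (1 : Matrix (Fin n) (Fin n) K) i j := by
  -- two row operations suffice to make the diagonal entry equal to one
  obtain ⟨b, hb, hbM, hbk⟩ : ∃ b ∈ elementaryMatrices K n ^ 2,
      (∀ j, j < k → ∀ i, (b * M) i j = (1 : Matrix (Fin n) (Fin n) K) i j) ∧
      (b * M) k k = 1 := by
    have hrow : ∀ (N : SpecialLinearGroup (Fin n) K) {i l : Fin n} (hil : i ≠ l) (t : K),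
        k ≤ l → (∀ j, j < k → ∀ i, N i j = (1 : Matrix (Fin n) (Fin n) K) i j) →
        (∀ j, j < k → ∀ i', (transvection hil t * N) i' j =
          (1 : Matrix (Fin n) (Fin n) K) i' j) ∧
        (transvection hil t * N) i k = N i k + t * N l k := by
      intro N i l hil t hl hN
      refine ⟨fun j hj i' => ?_, transvection_mul_apply_same _ _ _ _ N.1⟩
      change (Matrix.transvection i l t * N.1) i' j = _
      by_cases hi : i' = i
      · subst hi
        rw [transvection_mul_apply_same]
        change N i' j + t * N l j = _
        rw [hN j hj, hN j hj, Matrix.one_apply_ne (hj.trans_le hl).ne', mul_zero, add_zero]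
      · rw [transvection_mul_apply_of_ne _ _ _ _ hi]
        exact hN j hj i'
    have hstep : ∀ (N : SpecialLinearGroup (Fin n) K) (l : Fin n), k < l → N l k ≠ 0 →
        (∀ j, j < k → ∀ i, N i j = (1 : Matrix (Fin n) (Fin n) K) i j) →
        ∃ b ∈ elementaryMatrices K n,
        (∀ j, j < k → ∀ i, (b * N) i j = (1 : Matrix (Fin n) (Fin n) K) i j) ∧
        (b * N) k k = 1 := by
      intro N l hl h0 hN
      obtain ⟨h1, h2⟩ := hrow N hl.ne ((1 - N k k) / N l k) hl.le hN
      refine ⟨_, transvection_mem_elementaryMatrices hl.ne _, h1, ?_⟩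
      rw [h2, div_mul_cancel₀ _ h0]; ring
    by_cases hex : ∃ l, k < l ∧ M l k ≠ 0
    · obtain ⟨l, hl, h0⟩ := hex
      obtain ⟨b, hb, h1, h2⟩ := hstep M l hl h0 hM
      exact ⟨b, Set.pow_subset_pow_right (one_mem_elementaryMatrices hn) one_le_two
        (by rwa [pow_one]), h1, h2⟩
    · push Not at hex
      -- the matrix is triangular up to column `k`, so that the diagonal entry is not zero
      have hkk : M k k ≠ 0 := by
        intro h0
        let w : Fin n → K := fun i => if i < k then -(M i k) else if i = k then 1 else 0
        have hw : M.1 *ᵥ w = 0 := by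
          ext i
          have h1 : ∀ j, M i j * w j = (if j < k then (1 : Matrix (Fin n) (Fin n) K) i j * w j
              else 0) + if j = k then M i k else 0 := by
            intro j
            rcases lt_trichotomy j k with h | h | h
            · rw [hM j h i, if_pos h, if_neg h.ne, add_zero]
            · subst h; simp [w]
            · simp [w, h.not_gt, h.ne']
          change ∑ j, M i j * w j = 0
          rw [Finset.sum_congr rfl fun j _ => h1 j, Finset.sum_add_distrib,
            Finset.sum_ite_eq' Finset.univ k, if_pos (Finset.mem_univ k),
            Finset.sum_eq_single i (fun j _ hj => by simp [Matrix.one_apply_ne hj.symm])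
              (by simp), Matrix.one_apply_eq, one_mul]
          rcases lt_trichotomy i k with h | h | h
          · simp [w, h]
          · subst h; simp [h0]
          · simp [h.not_gt, hex i h]
        have := congrFun (Matrix.eq_zero_of_mulVec_eq_zero M.det_ne_zero hw) k
        simp [w] at this
      by_cases hlast : k.1 + 1 < n
      · let l : Fin n := ⟨k.1 + 1, hlast⟩
        have hl : k < l := by simp [l, Fin.lt_def]
        obtain ⟨h1, h2⟩ := hrow M hl.ne' 1 le_rfl hM
        obtain ⟨b, hb, h3, h4⟩ := hstep _ l hl (by rw [h2, hex l hl]; simpa using hkk) h1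
        rw [← mul_assoc] at h3 h4
        refine ⟨_, ?_, h3, h4⟩
        rw [pow_two]
        exact Set.mul_mem_mul hb (transvection_mem_elementaryMatrices _ _)
      · -- in the last column the diagonal entry is the determinant
        refine ⟨1, Set.one_mem_pow (one_mem_elementaryMatrices hn), by simpa using hM, ?_⟩
        have hle : ∀ j, j ≠ k → j < k := fun j hj => by
          refine lt_of_le_of_ne ?_ hj
          rw [Fin.le_def]; omega
        have htri : M.1.BlockTriangular id := fun i j hji => by
          simp only [id] at hji
          have hjk : j < k := by
            rw [Fin.lt_def] at hji ⊢; omega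
          exact (hM j hjk i).trans (Matrix.one_apply_ne hji.ne')
        have hdet := Matrix.det_of_isUpperTriangular htri
        rw [M.2, Finset.prod_eq_single k (fun j _ hj =>
          (hM j (hle j hj) j).trans (Matrix.one_apply_eq j)) (by simp)] at hdet
        rw [one_mul]
        exact hdet.symm
  obtain ⟨a, ha, haM⟩ := exists_mem_pow_mul_apply (b * M) (Finset.univ.erase k)
    (Finset.notMem_erase k _)
  rw [Finset.card_erase_of_mem (Finset.mem_univ k), Finset.card_univ, Fintype.card_fin] at ha
  refine ⟨a * b, ?_, fun j hj i => ?_⟩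
  · rw [show n + 1 = (n - 1) + 2 by omega, pow_add]
    exact Set.mul_mem_mul ha hb
  · rw [mul_assoc, haM]
    rcases hj.lt_or_eq with hj | rfl
    · rw [hbM j hj, hbM j hj, Matrix.one_apply_ne hj.ne', mul_zero, sub_zero, ite_self]
    · by_cases hi : i = j
      · subst hi; simp [hbk]
      · simp [hi, hbk]

theorem mem_elementaryMatrices_pow (hn : 2 ≤ n) (g : SpecialLinearGroup (Fin n) K) :
    g ∈ elementaryMatrices K n ^ (n * (n + 1)) := by
  have key : ∀ k, k ≤ n → ∃ a ∈ elementaryMatrices K n ^ (k * (n + 1)), ∀ j : Fin n, j.1 < k →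
      ∀ i, (a * g⁻¹) i j = (1 : Matrix (Fin n) (Fin n) K) i j := by
    intro k
    induction k with
    | zero => exact fun _ => ⟨1, by simp, by simp⟩
    | succ k ih =>
      intro hk
      obtain ⟨a, ha, h1⟩ := ih (by omega)
      obtain ⟨b, hb, h2⟩ := exists_mem_pow_columns_succ hn (a * g⁻¹) ⟨k, hk⟩ h1
      refine ⟨b * a, ?_, fun j hj i => ?_⟩
      · rw [Nat.succ_mul, add_comm, pow_add]
        exact Set.mul_mem_mul hb ha
      · rw [mul_assoc]
        exact h2 j (by rw [Fin.le_def]; exact Nat.lt_succ_iff.mp hj) i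
  obtain ⟨a, ha, h⟩ := key n le_rfl
  have : a * g⁻¹ = 1 := Matrix.SpecialLinearGroup.ext _ _ fun i j => h j j.2 i
  rwa [← mul_inv_eq_one.mp this]

/-- Over every field, each matrix of determinant one is a product of `n * (n + 1)` elementary
matrices. -/
theorem exists_eq_prod_transvection (hn : 2 ≤ n) (g : SpecialLinearGroup (Fin n) K) :
    ∃ (s : Fin (n * (n + 1)) → {q : Fin n × Fin n // q.1 ≠ q.2}) (x : Fin (n * (n + 1)) → K),
      g = (List.ofFn fun r => SpecialLinearGroup.transvection (s r).2 (x r)).prod := by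
  obtain ⟨f, hf⟩ := Set.mem_pow.mp (mem_elementaryMatrices_pow hn g)
  choose s x hsx using fun r => (f r).2
  exact ⟨s, x, by rw [← hf]; congr 2; exact funext hsx⟩

end BoundedGeneration

/-! ### Uniform terms in fields and the interpretation of special linear groups -/

universe w

open FirstOrder FirstOrder.Language FirstOrder.Ring

/-- A field together with a compatible structure for the first-order language of rings. -/
structure LanguageField : Type (w + 1) where
  carrier : Type w
  [field : Field carrier]
  [compatible : CompatibleRing carrier]

attribute [instance] LanguageField.field LanguageField.compatible

namespace FirstOrder.Language.UniformTerm

section Ring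

variable {ι : Type*} {M : ι → Type*} [∀ i, Field (M i)] [∀ i, CompatibleRing (M i)] {α : Type*}
  {s t : ∀ i, (α → M i) → M i}

theorem ring_add (hs : UniformTerm Language.ring s) (ht : UniformTerm Language.ring t) :
    UniformTerm Language.ring fun i v => s i v + t i v := by
  obtain ⟨σ, hσ⟩ := hs
  obtain ⟨τ, hτ⟩ := ht
  exact ⟨σ + τ, fun i v => by rw [realize_add, hσ, hτ]⟩

theorem ring_mul (hs : UniformTerm Language.ring s) (ht : UniformTerm Language.ring t) :
    UniformTerm Language.ring fun i v => s i v * t i v := by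
  obtain ⟨σ, hσ⟩ := hs
  obtain ⟨τ, hτ⟩ := ht
  exact ⟨σ * τ, fun i v => by rw [realize_mul, hσ, hτ]⟩

theorem ring_neg (hs : UniformTerm Language.ring s) :
    UniformTerm Language.ring fun i v => -s i v := by
  obtain ⟨σ, hσ⟩ := hs
  exact ⟨-σ, fun i v => by rw [realize_neg, hσ]⟩

theorem ring_zero : UniformTerm Language.ring fun i (_ : α → M i) => (0 : M i) :=
  ⟨0, fun _ _ => realize_zero _⟩

theorem ring_one : UniformTerm Language.ring fun i (_ : α → M i) => (1 : M i) :=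
  ⟨1, fun _ _ => realize_one _⟩

theorem ring_natCast (m : ℕ) : UniformTerm Language.ring fun i (_ : α → M i) => (m : M i) := by
  induction m with
  | zero => simpa using ring_zero
  | succ m ih => simpa using ih.ring_add ring_one

theorem ring_sum {κ : Type*} (S : Finset κ) {f : κ → ∀ i, (α → M i) → M i}
    (hf : ∀ k, UniformTerm Language.ring (f k)) :
    UniformTerm Language.ring fun i v => ∑ k ∈ S, f k i v := by
  classical
  induction S using Finset.induction_on with
  | empty => simpa using ring_zero
  | insert a S ha ih => simpa [Finset.sum_insert ha] using (hf a).ring_add ih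

theorem ring_prod {κ : Type*} (S : Finset κ) {f : κ → ∀ i, (α → M i) → M i}
    (hf : ∀ k, UniformTerm Language.ring (f k)) :
    UniformTerm Language.ring fun i v => ∏ k ∈ S, f k i v := by
  classical
  induction S using Finset.induction_on with
  | empty => simpa using ring_one
  | insert a S ha ih => simpa [Finset.prod_insert ha] using (hf a).ring_mul ih

theorem ring_det {κ : Type*} [Fintype κ] [DecidableEq κ] {A : ∀ i, (α → M i) → Matrix κ κ (M i)}
    (hA : ∀ a b, UniformTerm Language.ring fun i v => A i v a b) :
    UniformTerm Language.ring fun i v => (A i v).det := by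
  simp only [Matrix.det_apply']
  refine ring_sum _ fun σ => ring_mul ?_ (ring_prod _ fun k => hA _ _)
  rcases Int.units_eq_one_or (Equiv.Perm.sign σ) with h | h
  · simpa [h] using ring_one
  · simpa [h] using ring_one.ring_neg

theorem ring_adjugate {κ : Type*} [Fintype κ] [DecidableEq κ]
    {A : ∀ i, (α → M i) → Matrix κ κ (M i)}
    (hA : ∀ a b, UniformTerm Language.ring fun i v => A i v a b) (a b : κ) :
    UniformTerm Language.ring fun i v => (A i v).adjugate a b := by
  simp only [Matrix.adjugate_apply]
  refine ring_det fun c d => ?_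
  by_cases hc : c = b
  · subst hc
    by_cases hd : d = a
    · subst hd
      simpa using ring_one
    · simpa [Pi.single_eq_of_ne hd] using ring_zero
  · simpa [Matrix.updateRow_ne hc] using hA c d

theorem ring_matrix_mul {κ : Type*} [Fintype κ] {A B : ∀ i, (α → M i) → Matrix κ κ (M i)}
    (hA : ∀ a b, UniformTerm Language.ring fun i v => A i v a b)
    (hB : ∀ a b, UniformTerm Language.ring fun i v => B i v a b) (a b : κ) :
    UniformTerm Language.ring fun i v => (A i v * B i v) a b := by
  simp only [Matrix.mul_apply]
  exact ring_sum _ fun k => (hA _ _).ring_mul (hB _ _)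

theorem ring_matrix_one {κ : Type*} [DecidableEq κ] (a b : κ) :
    UniformTerm Language.ring fun i (_ : α → M i) => (1 : Matrix κ κ (M i)) a b := by
  by_cases h : a = b
  · simpa [Matrix.one_apply, h] using ring_one
  · simpa [Matrix.one_apply, h] using ring_zero

end Ring

end FirstOrder.Language.UniformTerm

section InterpretSL

instance : groupLanguage.IsAlgebraic := fun _ => inferInstanceAs (IsEmpty Empty)

instance : Language.ring.IsAlgebraic := fun _ => inferInstanceAs (IsEmpty Empty)

/-- The special linear group is interpreted in its field: a matrix is coded by its entries. -/
theorem exists_ring_translation {α : Type*} {k n : ℕ} (φ : groupLanguage.BoundedFormula α k) :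
    ∃ ψ : Language.ring.Formula (((α ⊕ Fin k) × (Fin n × Fin n)) ⊕ Empty),
      ∀ (K : LanguageField.{w}) (v : α → Matrix.SpecialLinearGroup (Fin n) K.carrier)
        (xs : Fin k → Matrix.SpecialLinearGroup (Fin n) K.carrier),
      ψ.Realize (Sum.elim (fun q => (Sum.elim v xs q.1).1 q.2.1 q.2.2) Empty.elim) ↔
        φ.Realize v xs := by
  refine BoundedFormula.exists_translation (M := LanguageField.carrier)
    (N := fun K => Matrix.SpecialLinearGroup (Fin n) K.carrier)
    (e := fun K g (c : Fin n × Fin n) => g.1 c.1 c.2) (p := fun K => Empty.elim) ?_ ?_ ?_ φ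
  · exact fun K g h hgh => Matrix.SpecialLinearGroup.ext _ _ fun i j => congrFun hgh (i, j)
  · obtain ⟨δ, hδ⟩ := (UniformTerm.ring_det (M := LanguageField.carrier)
      (A := fun K (v : (Fin n × Fin n) ⊕ Empty → K.carrier) =>
        Matrix.of fun a b => v (.inl (a, b))) fun a b => UniformTerm.var _).eq
          UniformTerm.ring_one
    refine ⟨δ, fun K c => (hδ _ _).trans ⟨fun h => ⟨⟨_, h⟩, rfl⟩, ?_⟩⟩
    rintro ⟨g, rfl⟩
    exact g.2
  · rintro k f ⟨a, b⟩
    have entry : ∀ (j : Fin k) (a b : Fin n), UniformTerm Language.ring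
        fun (K : LanguageField.{w}) (v : (Fin k × (Fin n × Fin n)) ⊕ Empty → K.carrier) =>
          (Matrix.of fun a b => v (.inl (j, (a, b)))) a b := fun j a b => UniformTerm.var _
    cases f with
    | mul =>
      obtain ⟨τ, hτ⟩ := UniformTerm.ring_matrix_mul (M := LanguageField.carrier) (entry 0)
        (entry 1) a b
      exact ⟨τ, fun K x => hτ _ _⟩
    | inv =>
      obtain ⟨τ, hτ⟩ := UniformTerm.ring_adjugate (M := LanguageField.carrier) (entry 0) a b
      exact ⟨τ, fun K x => hτ _ _⟩
    | one =>
      obtain ⟨τ, hτ⟩ := UniformTerm.ring_matrix_one (M := LanguageField.carrier) (α := _) a b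
      exact ⟨τ, fun K x => hτ _ _⟩

theorem FieldElemEquiv.specialLinearGroup {F L : Type w} [Field F] [Field L] (n : ℕ)
    (h : FieldElemEquiv F L) : GroupElemEquiv (Matrix.SpecialLinearGroup (Fin n) F)
      (Matrix.SpecialLinearGroup (Fin n) L) := by
  refine elementarilyEquivalent_iff.mpr fun φ => ?_
  obtain ⟨ψ, hψ⟩ := exists_ring_translation (n := n) φ
  let KF : LanguageField := { carrier := F, compatible := compatibleRingOfRing F }
  let KL : LanguageField := { carrier := L, compatible := compatibleRingOfRing L }
  have key := ((UniformlyDefinable.of_formula (M := LanguageField.carrier) ψ).comp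
    (fun q => isEmptyElim q)).iff_of_elementarilyEquivalent (i := KF) (j := KL) h
  have h1 := hψ KF Empty.elim Fin.elim0
  have h2 := hψ KL Empty.elim Fin.elim0
  rw [Subsingleton.elim (Sum.elim _ _) (Empty.elim ∘ fun q => isEmptyElim q)] at h1 h2
  rw [Sentence.realize_iff_boundedFormula φ Empty.elim Fin.elim0,
    Sentence.realize_iff_boundedFormula φ Empty.elim Fin.elim0]
  exact h1.symm.trans (key.trans h2)

end InterpretSL

/-! ### Coordinates inside a group -/

namespace FirstOrder.Language.UniformTerm

section Group

variable {ι : Type*} {M : ι → Type*} [∀ i, Group (M i)] {α : Type*} {s t : ∀ i, (α → M i) → M i}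

theorem group_mul (hs : UniformTerm groupLanguage s) (ht : UniformTerm groupLanguage t) :
    UniformTerm groupLanguage fun i v => s i v * t i v := by
  have := UniformTerm.func (L := groupLanguage) (M := M) GroupFunc.mul (t := ![s, t])
    (by intro j; fin_cases j <;> assumption)
  exact this

theorem group_inv (hs : UniformTerm groupLanguage s) :
    UniformTerm groupLanguage fun i v => (s i v)⁻¹ :=
  UniformTerm.func (L := groupLanguage) (M := M) GroupFunc.inv (t := fun _ => s) fun _ => hs

theorem group_one : UniformTerm groupLanguage fun i (_ : α → M i) => (1 : M i) :=
  UniformTerm.func (L := groupLanguage) (M := M) GroupFunc.one (t := fun j => j.elim0)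
    fun j => j.elim0

open scoped commutatorElement in
theorem group_commutator (hs : UniformTerm groupLanguage s) (ht : UniformTerm groupLanguage t) :
    UniformTerm groupLanguage fun i v => ⁅s i v, t i v⁆ := by
  simp only [commutatorElement_def]
  exact ((hs.group_mul ht).group_mul hs.group_inv).group_mul ht.group_inv

theorem group_ofFn_prod {R : ℕ} {f : Fin R → ∀ i, (α → M i) → M i}
    (hf : ∀ r, UniformTerm groupLanguage (f r)) :
    UniformTerm groupLanguage fun i v => (List.ofFn fun r => f r i v).prod := by
  induction R with
  | zero => simpa using group_one
  | succ R ih =>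
    simp only [List.ofFn_succ, List.prod_cons]
    exact (hf 0).group_mul (ih fun r => hf r.succ)

end Group

end FirstOrder.Language.UniformTerm

section Coordinates

open scoped commutatorElement

variable {m : ℕ} {K : Type*} [Group K]

/-- The parameters used to describe coordinates in a group: an element that plays the role of the
elementary matrix with entry `1` at the place `(0, 2)`, and for each place an element that
conjugates the root subgroup of `(0, 2)` to the one of that place. -/
abbrev CoordIndex (m : ℕ) : Type := Option (Fin (m + 3) × Fin (m + 3))

/-- The off-diagonal places of a square matrix. -/
abbrev OffDiag (m : ℕ) : Type := {q : Fin (m + 3) × Fin (m + 3) // q.1 ≠ q.2}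

/-- The element at the place `q` with the coordinate `x`. -/
def rootElem (p : CoordIndex m → K) (q : Fin (m + 3) × Fin (m + 3)) (x : K) : K :=
  p (some q) * x * (p (some q))⁻¹

/-- The coordinates, which in the special linear group are the elementary matrices at the place
`(0, 2)`: the commutators with a fixed elementary matrix at `(1, 2)` of the elements of the double
centralizer of an elementary matrix at `(0, 1)`. Passing to commutators removes the center. -/
def IsCoord (p : CoordIndex m → K) (x : K) : Prop :=
  ∃ y, (∀ z, z * rootElem p (0, 1) (p none) = rootElem p (0, 1) (p none) * z → y * z = z * y) ∧
    x = ⁅y, rootElem p (1, 2) (p none)⁆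

/-- The product of coordinates. Their sum is the product in the group. -/
def coordMul (p : CoordIndex m → K) (x y : K) : K :=
  ⁅rootElem p (0, 1) x, rootElem p (1, 2) y⁆

/-- The coordinates are closed under the ring operations. -/
def IsCoordClosed (p : CoordIndex m → K) : Prop :=
  (∀ x, IsCoord p x → ∀ y, IsCoord p y → IsCoord p (x * y) ∧ IsCoord p (coordMul p x y)) ∧
    (∀ x, IsCoord p x → IsCoord p x⁻¹) ∧ IsCoord p 1 ∧ IsCoord p (p none)

/-- The product of elements with given places and coordinates. -/
def rootWord (p : CoordIndex m → K) {R : ℕ} (s : Fin R → OffDiag m) (x : Fin R → K) : K :=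
  (List.ofFn fun r => rootElem p (s r).1 (x r)).prod

/-- A group with parameters for which the coordinates are closed under the ring operations. -/
structure CoordSystem (m : ℕ) : Type (w + 1) where
  carrier : Type w
  [group : Group carrier]
  param : CoordIndex m → carrier
  closed : IsCoordClosed param

attribute [instance] CoordSystem.group

/-- The type of coordinates. -/
def CoordSystem.Coord (S : CoordSystem.{w} m) : Type w := {x : S.carrier // IsCoord S.param x}

instance CoordSystem.ringStructure (S : CoordSystem.{w} m) : Language.ring.Structure S.Coord where
  funMap := fun {n} f =>
    match n, f with
    | _, .add => fun x => ⟨(x 0).1 * (x 1).1, (S.closed.1 _ (x 0).2 _ (x 1).2).1⟩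
    | _, .mul => fun x => ⟨coordMul S.param (x 0).1 (x 1).1, (S.closed.1 _ (x 0).2 _ (x 1).2).2⟩
    | _, .neg => fun x => ⟨(x 0).1⁻¹, S.closed.2.1 _ (x 0).2⟩
    | _, .zero => fun _ => ⟨1, S.closed.2.2.1⟩
    | _, .one => fun _ => ⟨S.param none, S.closed.2.2.2⟩
  RelMap := fun r => nomatch r

/-- The product of the elements of the group with given places and coordinates. -/
def CoordSystem.word (S : CoordSystem.{w} m) {R : ℕ} (s : Fin R → OffDiag m)
    (x : Fin R → S.Coord) : S.carrier :=
  rootWord S.param s fun r => (x r).1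

section Definability

variable {ι : Type*} {M : ι → Type*} [∀ i, Group (M i)] {α : Type*}
  {p : CoordIndex m → ∀ i, (α → M i) → M i} {x y : ∀ i, (α → M i) → M i}

theorem uniformTerm_rootElem (hp : ∀ r, UniformTerm groupLanguage (p r))
    (hx : UniformTerm groupLanguage x) (q : Fin (m + 3) × Fin (m + 3)) :
    UniformTerm groupLanguage fun i v => rootElem (fun r => p r i v) q (x i v) :=
  ((hp _).group_mul hx).group_mul (hp _).group_inv

theorem uniformTerm_coordMul (hp : ∀ r, UniformTerm groupLanguage (p r))
    (hx : UniformTerm groupLanguage x) (hy : UniformTerm groupLanguage y) :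
    UniformTerm groupLanguage fun i v => coordMul (fun r => p r i v) (x i v) (y i v) :=
  (uniformTerm_rootElem hp hx _).group_commutator (uniformTerm_rootElem hp hy _)

theorem uniformTerm_rootWord (hp : ∀ r, UniformTerm groupLanguage (p r)) {R : ℕ}
    (s : Fin R → OffDiag m) {f : Fin R → ∀ i, (α → M i) → M i}
    (hf : ∀ r, UniformTerm groupLanguage (f r)) :
    UniformTerm groupLanguage fun i v => rootWord (fun r => p r i v) s fun r => f r i v :=
  UniformTerm.group_ofFn_prod fun r => uniformTerm_rootElem hp (hf r) _

theorem uniformlyDefinable_isCoord (hp : ∀ r, UniformTerm groupLanguage (p r))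
    (hx : UniformTerm groupLanguage x) :
    UniformlyDefinable groupLanguage fun i v => IsCoord (fun r => p r i v) (x i v) := by
  have base : UniformlyDefinable groupLanguage fun i (v : CoordIndex m ⊕ Unit → M i) =>
      IsCoord (fun r => v (.inl r)) (v (.inr ())) := by
    refine UniformlyDefinable.exists_elem (UniformlyDefinable.and
      (UniformlyDefinable.forall_elem (UniformlyDefinable.imp ?_ ?_)) ?_)
    · exact ((UniformTerm.var _).group_mul (uniformTerm_rootElem (fun r => .var _)
        (.var _) _)).eq ((uniformTerm_rootElem (fun r => .var _) (.var _) _).group_mul (.var _))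
    · exact ((UniformTerm.var _).group_mul (.var _)).eq ((UniformTerm.var _).group_mul (.var _))
    · exact (UniformTerm.var _).eq ((UniformTerm.var _).group_commutator
        (uniformTerm_rootElem (fun r => .var _) (.var _) _))
  exact base.subst (t := Sum.elim p fun _ => x) (by rintro (r | r); exacts [hp r, hx])

theorem uniformlyDefinable_isCoordClosed :
    UniformlyDefinable groupLanguage fun i (p : CoordIndex m → M i) => IsCoordClosed p := by
  refine .and (.forall_elem (.imp ?_ (.forall_elem (.imp ?_ (.and ?_ ?_)))))
    (.and (.forall_elem (.imp ?_ ?_)) (.and ?_ ?_))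
  · exact uniformlyDefinable_isCoord (fun r => .var _) (.var _)
  · exact uniformlyDefinable_isCoord (fun r => .var _) (.var _)
  · exact uniformlyDefinable_isCoord (fun r => .var _) (.group_mul (.var _) (.var _))
  · exact uniformlyDefinable_isCoord (fun r => .var _)
      (uniformTerm_coordMul (fun r => .var _) (.var _) (.var _))
  · exact uniformlyDefinable_isCoord (fun r => .var _) (.var _)
  · exact uniformlyDefinable_isCoord (fun r => .var _) (.group_inv (.var _))
  · exact uniformlyDefinable_isCoord (fun r => .var _) .group_one
  · exact uniformlyDefinable_isCoord (fun r => .var _) (.var _)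

end Definability

/-- The ring of coordinates is interpreted in the group with parameters. -/
theorem exists_group_translation {β : Type} (φ : Language.ring.Formula β) :
    ∃ ψ : groupLanguage.Formula (β ⊕ CoordIndex m), ∀ (S : CoordSystem.{w} m) (v : β → S.Coord),
      ψ.Realize (Sum.elim (fun b => (v b).1) S.param) ↔ φ.Realize v := by
  refine Exists.elim (BoundedFormula.exists_translation (L := groupLanguage)
    (M := CoordSystem.carrier.{w} (m := m))
    (N := CoordSystem.Coord.{w} (m := m)) (C := Unit) (e := fun S x _ => x.1)
    (p := CoordSystem.param) ?_ ?_ ?_ φ) fun ψ hψ => ?_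
  · exact fun S x y h => Subtype.ext (congrFun h ())
  · obtain ⟨δ, hδ⟩ := uniformlyDefinable_isCoord (M := CoordSystem.carrier.{w} (m := m))
      (α := Unit ⊕ CoordIndex m) (p := fun r i v => v (.inr r)) (x := fun i v => v (.inl ()))
      (fun r => .var _) (.var _)
    refine ⟨δ, fun S c => (hδ _ _).trans ⟨fun h => ⟨⟨_, h⟩, rfl⟩, ?_⟩⟩
    rintro ⟨x, rfl⟩
    exact x.2
  · rintro k f ⟨⟩
    have hp : ∀ r : CoordIndex m, UniformTerm groupLanguage
      fun (S : CoordSystem.{w} m) (v : (Fin k × Unit) ⊕ CoordIndex m → S.carrier) => v (.inr r) :=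
      fun r => .var _
    have hx : ∀ j : Fin k, UniformTerm groupLanguage
      fun (S : CoordSystem.{w} m) (v : (Fin k × Unit) ⊕ CoordIndex m → S.carrier) =>
        v (.inl (j, ())) := fun r => .var _
    cases f with
    | add =>
      obtain ⟨τ, hτ⟩ := (hx 0).group_mul (hx 1)
      exact ⟨τ, fun S x => hτ _ _⟩
    | mul =>
      obtain ⟨τ, hτ⟩ := uniformTerm_coordMul hp (hx 0) (hx 1)
      exact ⟨τ, fun S x => hτ _ _⟩
    | neg =>
      obtain ⟨τ, hτ⟩ := (hx 0).group_inv
      exact ⟨τ, fun S x => hτ _ _⟩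
    | zero =>
      obtain ⟨τ, hτ⟩ := UniformTerm.group_one (M := CoordSystem.carrier.{w} (m := m))
        (α := (Fin 0 × Unit) ⊕ CoordIndex m)
      exact ⟨τ, fun S x => hτ _ _⟩
    | one =>
      obtain ⟨τ, hτ⟩ := hp none
      exact ⟨τ, fun S x => hτ _ _⟩
  · refine ⟨ψ.relabel (Sum.map (fun q => Sum.elim id (fun j => j.elim0) q.1) id), fun S v => ?_⟩
    rw [Formula.realize_relabel]
    refine Iff.trans ?_ (hψ S v default)
    refine iff_of_eq (congrArg _ (funext fun q => ?_))
    rcases q with ⟨b | j, _⟩ | r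
    · rfl
    · exact j.elim0
    · rfl

end Coordinates

/-! ### Coordinatized groups -/

section Coordinatization

open Matrix Matrix.SpecialLinearGroup
open scoped commutatorElement

variable {m : ℕ}

/-- The product of elementary matrices with given places and entries. -/
def elementaryWord {K : Type*} [Field K] {R : ℕ} (s : Fin R → OffDiag m) (x : Fin R → K) :
    SpecialLinearGroup (Fin (m + 3)) K :=
  (List.ofFn fun r => SpecialLinearGroup.transvection (s r).2 (x r)).prod

/-- Whether the product of two words is a third one is expressed by a formula about the entries that
does not depend on the field. -/
theorem exists_elementaryWord_formula {R : ℕ} (s s' s'' : Fin R → OffDiag m) :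
    ∃ φ : Language.ring.Formula (Fin R ⊕ (Fin R ⊕ Fin R)),
      ∀ (K : LanguageField.{w}) (x y z : Fin R → K.carrier),
        φ.Realize (Sum.elim x (Sum.elim y z)) ↔
          elementaryWord s x * elementaryWord s' y = elementaryWord s'' z := by
  have entry : ∀ {R' : ℕ} (s : Fin R' → OffDiag m) (g : Fin R' → Fin R ⊕ (Fin R ⊕ Fin R))
      (a b : Fin (m + 3)), UniformTerm Language.ring
        fun (K : LanguageField.{w}) (v : Fin R ⊕ (Fin R ⊕ Fin R) → K.carrier) =>
          (elementaryWord s fun r => v (g r)).1 a b := by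
    intro R'
    induction R' with
    | zero => exact fun s g a b => UniformTerm.ring_matrix_one a b
    | succ R' ih =>
      intro s g a b
      simp only [elementaryWord, List.ofFn_succ, List.prod_cons]
      refine UniformTerm.ring_matrix_mul (M := LanguageField.carrier)
        (A := fun K v => (SpecialLinearGroup.transvection (s 0).2 (v (g 0))).1)
        (fun c d => ?_) (ih (fun r => s r.succ) fun r => g r.succ) a b
      simp only [transvection_coe, Matrix.add_apply, Matrix.single_apply]
      refine (UniformTerm.ring_matrix_one c d).ring_add ?_
      split_ifs
      · exact .var _
      · exact .ring_zero
  obtain ⟨φ, hφ⟩ := UniformlyDefinable.forall_finite (κ := Fin (m + 3) × Fin (m + 3)) fun c =>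
    (UniformTerm.ring_matrix_mul (M := LanguageField.carrier)
      (entry s fun r => .inl r) (entry s' fun r => .inr (.inl r)) c.1 c.2).eq
      (entry s'' (fun r => .inr (.inr r)) c.1 c.2)
  refine ⟨φ, fun K x y z => (hφ _ _).trans ⟨fun h => ?_, fun h c => ?_⟩⟩
  · exact Matrix.SpecialLinearGroup.ext _ _ fun i j => h (i, j)
  · exact congrArg (fun g => g.1 c.1 c.2) h

/-- The number of elementary matrices of degree `m + 3` that suffice to write every matrix of
determinant one as a product. -/
abbrev wordLength (m : ℕ) : ℕ := (m + 3) * (m + 3 + 1)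

/-- A group with parameters is coordinatized if its coordinates form a field satisfying `χ` and if
it is described by words in the same way as the special linear group over this field. The condition
on products of words is passed through formulas of the language of rings, so that it makes sense
before the coordinates are known to form a field. -/
def CoordSystem.IsCoordinatized (S : CoordSystem.{w} m) (χ : Language.ring.Sentence) : Prop :=
  (∀ ax : Field.FieldAxiom, S.Coord ⊨ ax.toSentence) ∧ S.Coord ⊨ χ ∧
    (∀ g, ∃ (s : Fin (wordLength m) → OffDiag m) (x : Fin (wordLength m) → S.Coord),
      g = S.word s x) ∧
    ∀ (s s' s'' : Fin (wordLength m) → OffDiag m) (x y z : Fin (wordLength m) → S.Coord),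
      S.word s x * S.word s' y = S.word s'' z ↔
        (exists_elementaryWord_formula.{w} s s' s'').choose.Realize (Sum.elim x (Sum.elim y z))

instance : Finite Field.FieldAxiom :=
  Finite.of_surjective (![.addAssoc, .zeroAdd, .negAddCancel, .mulAssoc, .mulComm,
    .oneMul, .existsInv, .leftDistrib, .existsPairNE] : Fin 9 → Field.FieldAxiom) (by
      rintro ⟨⟩
      exacts [⟨0, rfl⟩, ⟨1, rfl⟩, ⟨2, rfl⟩, ⟨3, rfl⟩, ⟨4, rfl⟩, ⟨5, rfl⟩, ⟨6, rfl⟩, ⟨7, rfl⟩,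
        ⟨8, rfl⟩])

theorem exists_group_sentence_translation (χ : Language.ring.Sentence) :
    ∃ ψ : groupLanguage.Formula (CoordIndex m), ∀ S : CoordSystem.{w} m,
      ψ.Realize S.param ↔ S.Coord ⊨ χ := by
  obtain ⟨ψ, hψ⟩ := exists_group_translation.{w} (m := m) χ
  refine ⟨ψ.relabel (Sum.elim (fun a => a.elim) id), fun S => ?_⟩
  rw [Formula.realize_relabel]
  refine Iff.trans (iff_of_eq (congrArg _ (funext fun q => ?_))) (hψ S default)
  rcases q with ⟨⟨⟩⟩ | r
  rfl

theorem uniformlyDefinable_isCoordinatized (χ : Language.ring.Sentence) :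
    UniformlyDefinable groupLanguage fun (G : GrpCat.{w}) (p : CoordIndex m → G) =>
      ∃ h : IsCoordClosed p, (CoordSystem.mk (G : Type w) p h).IsCoordinatized χ := by
  choose ψ hψ using fun ax : Field.FieldAxiom =>
    exists_group_sentence_translation.{w} (m := m) ax.toSentence
  obtain ⟨ξ, hξ⟩ := exists_group_sentence_translation.{w} (m := m) χ
  choose ω hω using fun s s' s'' : Fin (wordLength m) → OffDiag m =>
    exists_group_translation.{w} (m := m) (exists_elementaryWord_formula.{w} s s' s'').choose
  have key : UniformlyDefinable groupLanguage fun (G : GrpCat.{w}) (p : CoordIndex m → G) =>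
      IsCoordClosed p ∧ (∀ ax, (ψ ax).Realize p) ∧ ξ.Realize p ∧
        (∀ g, ∃ s : Fin (wordLength m) → OffDiag m, ∃ x : Fin (wordLength m) → G,
          (∀ r, IsCoord p (x r)) ∧ g = rootWord p s x) ∧
        ∀ s s' s'' : Fin (wordLength m) → OffDiag m,
          ∀ v : Fin (wordLength m) ⊕ (Fin (wordLength m) ⊕ Fin (wordLength m)) → G,
          (∀ r, IsCoord p (v r)) →
            (rootWord p s (fun r => v (.inl r)) * rootWord p s' (fun r => v (.inr (.inl r))) =
              rootWord p s'' (fun r => v (.inr (.inr r))) ↔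
              (ω s s' s'').Realize (Sum.elim v p)) := by
    refine .and uniformlyDefinable_isCoordClosed (.and (.forall_finite fun ax => .of_formula _)
      (.and (.of_formula _) (.and ?_ ?_)))
    · refine .forall_elem (.exists_finite fun s => .exists_fun
        (.and (.forall_finite fun r => ?_) ?_))
      · exact uniformlyDefinable_isCoord (fun r => .var _) (.var _)
      · exact (UniformTerm.var _).eq (uniformTerm_rootWord (fun r => .var _) _ fun r => .var _)
    · refine .forall_finite fun s => .forall_finite fun s' => .forall_finite fun s'' =>
        .forall_fun (.imp (.forall_finite fun r => ?_) (.iff ?_ ?_))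
      · exact uniformlyDefinable_isCoord (fun r => .var _) (.var _)
      · exact ((uniformTerm_rootWord (fun r => .var _) _ fun r => .var _).group_mul
          (uniformTerm_rootWord (fun r => .var _) _ fun r => .var _)).eq
          (uniformTerm_rootWord (fun r => .var _) _ fun r => .var _)
      · exact ((UniformlyDefinable.of_formula (ω s s' s'')).subst
          (t := fun q (G : GrpCat.{w}) v => Sum.elim (fun r => v (.inr r)) (fun r => v (.inl r)) q)
          (by rintro (r | r) <;> exact .var _)).congr fun G v =>
            iff_of_eq (congrArg _ (funext fun q => by rcases q with q | q <;> rfl))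
  refine key.congr fun G p => ?_
  constructor
  · rintro ⟨hp, h1, h2, h3, h4⟩
    let S : CoordSystem m := ⟨G, p, hp⟩
    refine ⟨hp, fun ax => (hψ ax S).mp (h1 ax), (hξ S).mp h2, fun g => ?_,
      fun s s' s'' x y z => ?_⟩
    · obtain ⟨s, x, hx, hg⟩ := h3 g
      exact ⟨s, fun r => ⟨x r, hx r⟩, hg⟩
    · have hv : ∀ r, IsCoord p ((Sum.elim x (Sum.elim y z) : _ → S.Coord) r).1 := fun r =>
        Subtype.property _
      exact (h4 s s' s'' (fun r => ((Sum.elim x (Sum.elim y z) : _ → S.Coord) r).1) hv).trans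
        (hω s s' s'' S _)
  · rintro ⟨hp, h1, h2, h3, h4⟩
    let S : CoordSystem m := ⟨G, p, hp⟩
    refine ⟨hp, fun ax => (hψ ax S).mpr (h1 ax), (hξ S).mpr h2, fun g => ?_,
      fun s s' s'' v hv => ?_⟩
    · obtain ⟨s, x, hg⟩ := h3 g
      exact ⟨s, fun r => (x r).1, fun r => (x r).2, hg⟩
    · refine (h4 s s' s'' (fun r => ⟨_, hv (.inl r)⟩) (fun r => ⟨_, hv (.inr (.inl r))⟩)
        (fun r => ⟨_, hv (.inr (.inr r))⟩)).trans ((hω s s' s'' S _).symm.trans ?_)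
      refine iff_of_eq (congrArg _ (funext fun q => ?_))
      rcases q with (q | q | q) | q <;> rfl

end Coordinatization

/-! ### The special linear group of the field of coordinates -/

section FieldOfCoordinates

open Matrix Matrix.SpecialLinearGroup
open scoped commutatorElement

variable {m : ℕ}

/-- Two groups whose elements are named by the same set are isomorphic if the same products of named
elements hold in them. Equality of named elements need not be assumed to agree: it is the case of a
product with `1`. -/
theorem nonempty_mulEquiv_of_surjective {A G H : Type*} [Group G] [Group H] (f : A → G) (g : A → H)
    (hf : Function.Surjective f) (hg : Function.Surjective g)
    (h : ∀ a b c, f a * f b = f c ↔ g a * g b = g c) : Nonempty (G ≃* H) := by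
  obtain ⟨o, ho⟩ := hf 1
  have ho' : g o = 1 := by
    have := (h o o o).mp (by rw [ho, one_mul])
    rwa [mul_eq_left] at this
  have heq : ∀ a b, f a = f b ↔ g a = g b := fun a b => by
    have := h a o b
    rwa [ho, ho', mul_one, mul_one] at this
  have hinv : ∀ a, g (Function.surjInv hf (f a)) = g a := fun a =>
    (heq _ _).mp (Function.surjInv_eq hf _)
  refine ⟨MulEquiv.ofBijective (MonoidHom.mk' (fun x => g (Function.surjInv hf x)) fun x y => ?_)
    ⟨fun x y hxy => ?_, fun y => ?_⟩⟩
  · refine ((h _ _ _).mp ?_).symm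
    simp only [Function.surjInv_eq]
  · have := (heq _ _).mpr hxy
    rwa [Function.surjInv_eq hf, Function.surjInv_eq hf] at this
  · obtain ⟨a, rfl⟩ := hg y
    exact ⟨f a, hinv a⟩

/-- The coordinates as a field, if they satisfy the field axioms. -/
noncomputable def CoordSystem.languageField (S : CoordSystem.{w} m)
    (h : ∀ ax : Field.FieldAxiom, S.Coord ⊨ ax.toSentence) : LanguageField.{w} :=
  haveI : Theory.field.Model S.Coord := ⟨by rintro _ ⟨ax, rfl⟩; exact h ax⟩
  letI := Field.fieldOfModelField S.Coord
  { carrier := S.Coord, compatible := Field.compatibleRingOfModelField S.Coord }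

/-- A coordinatized group is isomorphic to the special linear group over its field of coordinates,
an element being mapped to the matrix given by the same word. -/
theorem CoordSystem.IsCoordinatized.nonempty_mulEquiv {S : CoordSystem.{w} m}
    {χ : Language.ring.Sentence} (h : S.IsCoordinatized χ) :
    Nonempty (S.carrier ≃* SpecialLinearGroup (Fin (m + 3)) (S.languageField h.1).carrier) := by
  obtain ⟨h1, -, h3, h4⟩ := h
  refine nonempty_mulEquiv_of_surjective
    (A := (Fin (wordLength m) → OffDiag m) × (Fin (wordLength m) → S.Coord))
    (fun a => S.word a.1 a.2)
    (fun a => elementaryWord (K := (S.languageField h1).carrier) a.1 a.2) ?_ ?_ ?_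
  · intro g
    obtain ⟨s, x, hg⟩ := h3 g
    exact ⟨(s, x), hg.symm⟩
  · intro g
    obtain ⟨s, x, hg⟩ := exists_eq_prod_transvection (by omega) g
    exact ⟨(s, x), hg.symm⟩
  · rintro ⟨s, x⟩ ⟨s', y⟩ ⟨s'', z⟩
    exact (h4 s s' s'' x y z).trans
      ((exists_elementaryWord_formula.{w} s s' s'').choose_spec (S.languageField h1) x y z)

/-- The special linear group over a field satisfying `χ` has parameters for which it is
coordinatized. -/
theorem exists_isCoordinatized (K : LanguageField.{w}) {χ : Language.ring.Sentence}
    (hχ : K.carrier ⊨ χ) :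
    ∃ (p : CoordIndex m → SpecialLinearGroup (Fin (m + 3)) K.carrier) (h : IsCoordClosed p),
      (CoordSystem.mk _ p h).IsCoordinatized χ := by
  have hcard : 3 ≤ Fintype.card (Fin (m + 3)) := by simp
  have h01 : (0 : Fin (m + 3)) ≠ 1 := Fin.ne_of_val_ne (by simp)
  have h12 : (1 : Fin (m + 3)) ≠ 2 := Fin.ne_of_val_ne (by simp [Nat.mod_eq_of_lt])
  have h02 : (0 : Fin (m + 3)) ≠ 2 := Fin.ne_of_val_ne (by simp [Nat.mod_eq_of_lt])
  choose W hW using fun q : OffDiag m =>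
    exists_conj_transvection (K := K.carrier) hcard h02 q.2
  let p : CoordIndex m → SpecialLinearGroup (Fin (m + 3)) K.carrier := fun r =>
    r.elim (SpecialLinearGroup.transvection h02 1) fun q => if h : q.1 ≠ q.2 then W ⟨q, h⟩ else 1
  have hroot : ∀ (q : Fin (m + 3) × Fin (m + 3)) (h : q.1 ≠ q.2) (t : K.carrier),
      rootElem p q (SpecialLinearGroup.transvection h02 t) =
        SpecialLinearGroup.transvection h t := by
    intro q h t
    simp only [rootElem, p, Option.elim_some, dif_pos h]
    exact hW ⟨q, h⟩ t
  have hnone : p none = SpecialLinearGroup.transvection h02 1 := rfl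
  have hcoord : ∀ x, IsCoord p x ↔ ∃ t : K.carrier, SpecialLinearGroup.transvection h02 t = x := by
    intro x
    simp only [IsCoord, hnone, hroot (0, 1) h01, hroot (1, 2) h12]
    constructor
    · -- the central factor of `y` does not contribute to the commutator
      rintro ⟨y, hy, rfl⟩
      obtain ⟨c, hc, t, rfl⟩ := exists_eq_center_mul_transvection hcard h01 y hy
      refine ⟨t, ?_⟩
      have hcomm : ∀ z w : SpecialLinearGroup (Fin (m + 3)) K.carrier, ⁅c * z, w⁆ = ⁅z, w⁆ := by
        intro z w
        have hcw := Subgroup.mem_center_iff.mp hc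
        calc ⁅c * z, w⁆ = c * (z * w * z⁻¹) * c⁻¹ * w⁻¹ := by rw [commutatorElement_def]; group
          _ = ⁅z, w⁆ := by rw [← hcw, mul_inv_cancel_right, commutatorElement_def]
      rw [hcomm, commutator_transvection h01 h12 h02, mul_one]
    · rintro ⟨t, rfl⟩
      refine ⟨SpecialLinearGroup.transvection h01 t, fun z hz => ?_, ?_⟩
      · have h1 := (commute_transvection_iff h01 z).mp hz
        refine Subtype.ext (Commute.symm ?_ : Commute (SpecialLinearGroup.transvection h01 t).1 z.1)
        rw [coe_transvection_eq_vecMulVec]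
        exact (Commute.one_right _).add_right (h1.smul_right t)
      · rw [commutator_transvection h01 h12 h02, mul_one]
  have hclosed : IsCoordClosed p := by
    simp only [IsCoordClosed, hcoord]
    refine ⟨?_, ?_, ⟨0, by simp⟩, ⟨1, rfl⟩⟩
    · rintro _ ⟨s, rfl⟩ _ ⟨t, rfl⟩
      refine ⟨⟨s + t, transvection_add _ _ _⟩, ⟨s * t, ?_⟩⟩
      rw [coordMul, hroot (0, 1) h01, hroot (1, 2) h12, commutator_transvection h01 h12 h02]
    · rintro _ ⟨s, rfl⟩
      exact ⟨-s, (transvection_inv _ _).symm⟩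
  let S : CoordSystem.{w} m := ⟨_, p, hclosed⟩
  let f : K.carrier → S.Coord := fun t =>
    ⟨SpecialLinearGroup.transvection h02 t, (hcoord _).mpr ⟨t, rfl⟩⟩
  have hf : Function.Bijective f := by
    refine ⟨fun s t hst => transvection_injective h02 (congrArg Subtype.val hst), fun x => ?_⟩
    obtain ⟨t, ht⟩ := (hcoord x.1).mp x.2
    exact ⟨t, Subtype.ext ht⟩
  let e : K.carrier ≃[Language.ring] S.Coord :=
    { Equiv.ofBijective f hf with
      map_fun' := fun {k} g x => by
        refine Subtype.ext ?_
        cases g with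
        | add =>
          change (f (Structure.funMap addFunc x)).1 = (f (x 0)).1 * (f (x 1)).1
          rw [CompatibleRing.funMap_add]
          exact transvection_add h02 _ _
        | mul =>
          change (f (Structure.funMap mulFunc x)).1 = coordMul p (f (x 0)).1 (f (x 1)).1
          rw [CompatibleRing.funMap_mul]
          simp only [f, coordMul, hroot (0, 1) h01, hroot (1, 2) h12,
            commutator_transvection h01 h12 h02]
        | neg =>
          change (f (Structure.funMap negFunc x)).1 = (f (x 0)).1⁻¹
          rw [CompatibleRing.funMap_neg]
          exact (transvection_inv h02 _).symm
        | zero =>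
          change (f (Structure.funMap zeroFunc x)).1 = 1
          rw [CompatibleRing.funMap_zero]
          exact transvection_coeff_zero h02
        | one =>
          change (f (Structure.funMap oneFunc x)).1 = p none
          rw [CompatibleRing.funMap_one]
          rfl
      map_rel' := fun r => nomatch r }
  have hword : ∀ (s : Fin (wordLength m) → OffDiag m) (x : Fin (wordLength m) → K.carrier),
      S.word s (fun r => f (x r)) = elementaryWord s x := by
    intro s x
    simp only [CoordSystem.word, rootWord, elementaryWord]
    congr 2
    exact funext fun r => hroot _ (s r).2 _
  have hsurj : ∀ x : Fin (wordLength m) → S.Coord, ∃ y : Fin (wordLength m) → K.carrier,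
      x = fun r => f (y r) := fun x =>
    ⟨fun r => (hf.2 (x r)).choose, funext fun r => (hf.2 (x r)).choose_spec.symm⟩
  refine ⟨p, hclosed, fun ax => ?_, ?_, fun g => ?_, fun s s' s'' x y z => ?_⟩
  · rw [← StrongHomClass.realize_sentence e]
    exact Theory.realize_sentence_of_mem Theory.field (Set.mem_range_self ax)
  · exact (StrongHomClass.realize_sentence e χ).mp hχ
  · obtain ⟨s, x, hg⟩ := exists_eq_prod_transvection (by omega) g
    exact ⟨s, fun r => f (x r), hg.trans (hword s x).symm⟩
  · obtain ⟨x, rfl⟩ := hsurj x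
    obtain ⟨y, rfl⟩ := hsurj y
    obtain ⟨z, rfl⟩ := hsurj z
    change S.word s _ * S.word s' _ = S.word s'' _ ↔ _
    rw [hword, hword, hword,
      ← (exists_elementaryWord_formula.{w} s s' s'').choose_spec K x y z,
      ← StrongHomClass.realize_formula e]
    refine iff_of_eq (congrArg _ (funext fun q => ?_))
    rcases q with q | q | q <;> rfl

theorem realize_sentence_iff_of_ringEquiv {R S : Type*} [Field R] [Field S] [CompatibleRing R]
    [CompatibleRing S] (e : R ≃+* S) (σ : Language.ring.Sentence) : R ⊨ σ ↔ S ⊨ σ :=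
  StrongHomClass.realize_sentence (languageEquivEquivRingEquiv.symm e) σ

/-- For parameters in the special linear group over `F` for which it is coordinatized, the field of
coordinates is isomorphic to `F`, by the isomorphism theorem for special linear groups. -/
theorem CoordSystem.IsCoordinatized.nonempty_ringEquiv {F : Type w} [Field F]
    {S : CoordSystem.{w} m} {χ : Language.ring.Sentence} (h : S.IsCoordinatized χ)
    (e : S.carrier ≃* SpecialLinearGroup (Fin (m + 3)) F)
    (hχ : ∀ K : LanguageField.{w}, K.carrier ⊨ χ ↔
      (ringChar F : K.carrier) = 0 ∧ (ringChar F = 0 → ((m + 3).factorial : K.carrier) ≠ 0)) :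
    Nonempty ((S.languageField h.1).carrier ≃+* F) := by
  obtain ⟨θ⟩ := h.nonempty_mulEquiv
  have hχL := (hχ (S.languageField h.1)).mp h.2.1
  exact nonempty_ringEquiv_of_mulEquiv_specialLinearGroup (by omega) (θ.symm.trans e) hχL.1 hχL.2

/-- The condition on the characteristic of a field that the isomorphism theorem for special linear
groups requires is expressed by a sentence. -/
theorem exists_sentence_characteristic (q N : ℕ) : ∃ χ : Language.ring.Sentence,
    ∀ K : LanguageField.{w}, K.carrier ⊨ χ ↔
      (q : K.carrier) = 0 ∧ (q = 0 → (N : K.carrier) ≠ 0) := by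
  obtain ⟨χ, hχ⟩ := (((UniformTerm.ring_natCast q).eq .ring_zero).and
    ((UniformlyDefinable.const (q = 0)).imp ((UniformTerm.ring_natCast N).eq .ring_zero).not) :
    UniformlyDefinable Language.ring (M := LanguageField.carrier.{w}) (α := Empty) _)
  exact ⟨χ, fun K => hχ K default⟩

/-- The existence of suitable parameters is transferred from the special linear group to `H`. That
all suitable parameters define a field satisfying a given sentence of the theory of the original
field is transferred as well. -/
theorem GroupElemEquiv.exists_languageField {H : Type w} [Group H] (K : LanguageField.{w})
    (h : GroupElemEquiv H (SpecialLinearGroup (Fin (m + 3)) K.carrier)) :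
    ∃ L : LanguageField.{w}, (∀ σ : Language.ring.Sentence, K.carrier ⊨ σ ↔ L.carrier ⊨ σ) ∧
      Nonempty (H ≃* SpecialLinearGroup (Fin (m + 3)) L.carrier) := by
  obtain ⟨χ, hχ⟩ := exists_sentence_characteristic.{w} (ringChar K.carrier) (m + 3).factorial
  have hFχ : K.carrier ⊨ χ := by
    refine (hχ K).mpr ⟨ringChar.Nat.cast_ringChar, fun h0 => ?_⟩
    have : CharZero K.carrier := (CharP.ringChar_zero_iff_CharZero _).mp h0
    exact Nat.cast_ne_zero.mpr (Nat.factorial_ne_zero _)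
  have hdef := uniformlyDefinable_isCoordinatized.{w} (m := m) χ
  let GH := GrpCat.of H
  let GF := GrpCat.of (SpecialLinearGroup (Fin (m + 3)) K.carrier)
  have hex := ((hdef.comp Sum.inr).exists_fun (α := Empty)
    (P := fun (G : GrpCat.{w}) _ p => ∃ h : IsCoordClosed p,
      (CoordSystem.mk (G : Type w) p h).IsCoordinatized χ)).iff_of_elementarilyEquivalent
    (i := GH) (j := GF) h
  obtain ⟨p, hp, hS⟩ := hex.mpr (exists_isCoordinatized K hFχ)
  have hσ : ∀ σ : Language.ring.Sentence, K.carrier ⊨ σ →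
      (CoordSystem.mk (GH : Type w) p hp).Coord ⊨ σ := by
    intro σ hσF
    obtain ⟨ψ, hψ⟩ := exists_group_sentence_translation.{w} (m := m) σ
    have hall := (((hdef.imp (.of_formula ψ)).comp Sum.inr).forall_fun (α := Empty)
      (P := fun (G : GrpCat.{w}) _ p => (∃ h : IsCoordClosed p,
        (CoordSystem.mk (G : Type w) p h).IsCoordinatized χ) →
          ψ.Realize p)).iff_of_elementarilyEquivalent (i := GH) (j := GF) h
    refine (hψ _).mp (hall.mpr ?_ p ⟨hp, hS⟩)
    rintro p' ⟨hp', hS'⟩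
    obtain ⟨e⟩ := hS'.nonempty_ringEquiv (MulEquiv.refl _) hχ
    exact (hψ (CoordSystem.mk (GF : Type w) p' hp')).mpr
      ((realize_sentence_iff_of_ringEquiv (S := K.carrier) e σ).mpr hσF)
  refine ⟨(CoordSystem.mk (GH : Type w) p hp).languageField hS.1, fun σ => ⟨hσ σ, fun h => ?_⟩,
    hS.nonempty_mulEquiv⟩
  by_contra hn
  exact (Sentence.realize_not _).mp (hσ σ.not ((Sentence.realize_not _).mpr hn)) h

theorem GroupElemEquiv.exists_field {F H : Type w} [Field F] [Group H]
    (h : GroupElemEquiv H (SpecialLinearGroup (Fin (m + 3)) F)) :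
    ∃ (L : Type w) (_ : Field L), FieldElemEquiv F L ∧
      Nonempty (H ≃* SpecialLinearGroup (Fin (m + 3)) L) := by
  let := compatibleRingOfRing F
  obtain ⟨L, hL, e⟩ := h.exists_languageField { carrier := F }
  refine ⟨L.carrier, L.field, (@elementarilyEquivalent_iff _ F L.carrier _
    (compatibleRingOfRing L.carrier).toStructure).mpr fun σ => (hL σ).trans ?_, e⟩
  exact @realize_sentence_iff_of_ringEquiv L.carrier L.carrier L.field L.field L.compatible
    (compatibleRingOfRing L.carrier) (RingEquiv.refl L.carrier) σ

end FieldOfCoordinates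

/-! ### Invariance under isomorphism and change of universe -/

section Universes

open Matrix

theorem GroupElemEquiv.of_mulEquiv {G H : Type*} [Group G] [Group H] (e : G ≃* H) :
    GroupElemEquiv G H :=
  StrongHomClass.elementarilyEquivalent (L := groupLanguage)
    ({ e.toEquiv with
      map_fun' := fun {k} f x => by
        cases f with
        | mul => exact map_mul e _ _
        | inv => exact map_inv e _
        | one => exact map_one e
      map_rel' := fun r => nomatch r } : G ≃[groupLanguage] H)

theorem FieldElemEquiv.of_ringEquiv {F L : Type*} [Field F] [Field L] (e : F ≃+* L) :
    FieldElemEquiv F L := by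
  let := compatibleRingOfRing F
  let := compatibleRingOfRing L
  exact elementarilyEquivalent_iff.mpr (realize_sentence_iff_of_ringEquiv e)

theorem FieldElemEquiv.trans {F L K : Type*} [Field F] [Field L] [Field K]
    (h : FieldElemEquiv F L) (h' : FieldElemEquiv L K) : FieldElemEquiv F K := by
  let := compatibleRingOfRing F
  let := compatibleRingOfRing L
  let := compatibleRingOfRing K
  exact ElementarilyEquivalent.trans h h'

/-- The isomorphism of special linear groups induced by an isomorphism of fields. -/
def specialLinearGroupCongr {F L : Type*} [Field F] [Field L] (n : ℕ) (e : F ≃+* L) :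
    SpecialLinearGroup (Fin n) F ≃* SpecialLinearGroup (Fin n) L :=
  MonoidHom.toMulEquiv (SpecialLinearGroup.map e.toRingHom)
    (SpecialLinearGroup.map e.symm.toRingHom) (by ext; simp) (by ext; simp)

end Universes

theorem theoremA2 {F : Type u} [Field F] (n : ℕ) (hn : 3 ≤ n) (H : Type v) [Group H] :
    GroupElemEquiv H (Matrix.SpecialLinearGroup (Fin n) F) ↔
      ∃ (L : Type v) (_ : Field L), FieldElemEquiv F L ∧
        Nonempty (H ≃* Matrix.SpecialLinearGroup (Fin n) L) := by
  obtain ⟨m, rfl⟩ : ∃ m, n = m + 3 := ⟨n - 3, by omega⟩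
  constructor
  · intro h
    -- both groups are lifted to a common universe
    have h' : GroupElemEquiv (ULift.{u} H)
        (Matrix.SpecialLinearGroup (Fin (m + 3)) (ULift.{v} F)) :=
      (ElementarilyEquivalent.trans (GroupElemEquiv.of_mulEquiv MulEquiv.ulift) h).trans
        (GroupElemEquiv.of_mulEquiv (specialLinearGroupCongr _ ULift.ringEquiv.symm))
    obtain ⟨L, _, hFL, ⟨e⟩⟩ := h'.exists_field
    have h01 : (0 : Fin (m + 3)) ≠ 1 := Fin.ne_of_val_ne (by simp)
    -- the field is embedded into `H` by elementary matrices, so that it has a copy in `Type v`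
    have : Small.{v} L := small_of_injective (β := H)
      (f := fun t => (e.symm (Matrix.SpecialLinearGroup.transvection h01 t)).down)
      fun s t hst => transvection_injective h01 (e.symm.injective (ULift.ext _ _ hst))
    exact ⟨Shrink.{v} L, inferInstance,
      ((FieldElemEquiv.of_ringEquiv ULift.ringEquiv.symm).trans hFL).trans
        (FieldElemEquiv.of_ringEquiv (Shrink.ringEquiv L).symm),
      ⟨(MulEquiv.ulift.symm.trans e).trans
        (specialLinearGroupCongr _ (Shrink.ringEquiv L).symm)⟩⟩
  · rintro ⟨L, _, hFL, ⟨e⟩⟩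
    have h' : FieldElemEquiv (ULift.{v} F) (ULift.{u} L) :=
      ((FieldElemEquiv.of_ringEquiv ULift.ringEquiv).trans hFL).trans
        (FieldElemEquiv.of_ringEquiv ULift.ringEquiv.symm)
    have h1 : GroupElemEquiv (Matrix.SpecialLinearGroup (Fin (m + 3)) F)
        (Matrix.SpecialLinearGroup (Fin (m + 3)) L) :=
      (ElementarilyEquivalent.trans
        (GroupElemEquiv.of_mulEquiv (specialLinearGroupCongr _ ULift.ringEquiv.symm))
        (h'.specialLinearGroup _)).trans
        (GroupElemEquiv.of_mulEquiv (specialLinearGroupCongr _ ULift.ringEquiv))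
    exact ElementarilyEquivalent.trans (GroupElemEquiv.of_mulEquiv e) h1.symm
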